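/- **Setting.** Let $Z=(X,A,Y)\sim P$ with $X\in\mathbb R^d$, $A\in\{0,1\}$, $Y\in\mathbb R$, and let $\Lambda\ge 1$, $\alpha=\Lambda/(\Lambda+1)$. Write $e^*(x)=P(A=1\mid X=x)$; let $f(\cdot\mid x,a)$ be the conditional density (assumed to exist) of $Y$ given $X=x,A=a$, and let $q^*_+(x,a)$, $q^*_-(x,a)$ be its conditional quantiles of levels $\alpha$ and $1-\alpha$. Put $\{b\}_+=\max(b,0)$, $\{b\}_-=\min(b,0)$, $$R_\pm(z,q)=\Lambda^{-1}y+(1-\Lambda^{-1})\Big(q(x,a)+\tfrac1{1-\alpha}\{y-q(x,a)\}_\pm\Big),\qquad \rho^*_\pm(x,a,q)=E[R_\pm(Z,q)\mid X=x,A=a],$$ and $\rho^*_\pm(x,a)=\rho^*_\pm(x,a,q^*_\pm)$. The sharp bounds $\tau^+(x)$ and $\tau^-(x)$ are the supremum and the infimum of $E_Q[Y(1)-Y(0)\mid X=x]$ over all conditional laws $Q$ of $(A,Y(1),Y(0),U)$ given $X=x$, with $U\in\mathbb R^k$ for some $k$, such that $(A,Y(A))$ has under $Q$ the conditional law of $(A,Y)$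 given $X=x$ under $P$, $A$ is independent of $(Y(1),Y(0))$ given $U$, and almost surely $0<Q(A=1\mid U)<1$ and $$\Lambda^{-1}\le \frac{Q(A=1\mid U)}{Q(A=0\mid U)}\Big/\frac{e^*(x)}{1-e^*(x)}\le\Lambda .$$ For nuisances $\eta=(e,q_\pm,\rho_\pm)$ let $\phi^\pm_\tau=\phi^\pm_1-\phi^\mp_0$, where $$\phi_1^\pm(Z,\eta)=AY+(1-A)\rho_\pm(X,1)+\tfrac{(1-e(X))A}{e(X)}\big(R_\pm(Z,q_\pm)-\rho_\pm(X,1)\big),$$ $$\phi_0^\pm(Z,\eta)=(1-A)Y+A\rho_\pm(X,0)+\tfrac{e(X)(1-A)}{1-e(X)}\big(R_\pm(Z,q_\pm)-\rho_\pm(X,0)\big).$$ **Estimator.** Let $Z_1,\dots,Z_n$ be i.i.d. from $P$, split into $K\ge2$ folds by the residue of the index modulo $K$, and let there be an auxiliary sample independent of them (possibly trivial). For each fold $k$, $\widehat\eta^{(k)}=(\widehat e,\widehat q_\pm,\widehat\rho_\pm)$ is a measurable function of the observations outside fold $k$ and of the auxiliary sample; the weights $w_i(\cdot)$ are measurable functions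 of $X_1,\dots,X_n$ and of the auxiliary sample. The estimated bounds are $$\widehat\tau^\pm(x)=\frac1n\sum_{i=1}^n w_i(x)\,\phi^\pm_\tau(Z_i,\widehat\eta^{(k(i))}),\qquad k(i)\text{ the fold of } i .$$ The evaluation point $x$ is drawn, independently of all samples, from a probability law $\nu$ on $\mathbb R^d$ (for instance $\nu=P_X$; $\nu=\delta_{x_0}$ is evaluation at a fixed point $x_0$). **Theorem.** Read the following twice, for the upper and for the lower signs. Only the nuisances that enter $\phi^\pm_\tau$ are concerned, namely $e$, $q_\pm(\cdot,1)$, $q_\mp(\cdot,0)$, $\rho_\pm(\cdot,1)$, $\rho_\mp(\cdot,0)$. Almost sure bounds and suprema over $x$ are with respect to $P_X$. Assume: 1. (Boundedness.) There are $\epsilon>0$ and $C<\infty$, not depending on $n$ and the fold, such that almost surely $\epsilon\le e^*,\widehat e\le 1-\epsilon$, $|Y|\le C$, and for every $\bar\eta$ on the segment between $\eta^*=(e^*,q^*_\pm,\rho^*_\pm)$ and $\widehat\eta^{(k)}$ the functions $\bar q$, $\bar\rho$ and $f(\bar q(x,a)\mid x,a)$ are bounded in absolute value by $C$. 2. (Requirements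 of Stone's (1977) Theorem 1 for $W_{ni}(x)=w_i(x)/n$ at the evaluation point $x\sim\nu$.) (a) For some $C'$, $E\sum_i|W_{ni}(x)|h(X_i)\le C'\,E\,h(X)$ for all $n$ and all Borel $h\ge0$; (b) for some $D$, $\sum_i|W_{ni}(x)|\le D$ almost surely for all $n$ (in particular $\frac1n\sum_i|w_i(x)|=O_P(1)$); (c) $\sum_i|W_{ni}(x)|\mathbf 1\{\|X_i-x\|>r\}\to0$ in probability for all $r>0$; (d) $\sum_iW_{ni}(x)\to1$ in probability; (e) $\max_i|W_{ni}(x)|\to0$ in probability. 3. For every fold, the quantile estimators converge uniformly in probability to some measurable, possibly wrong, limits: $\sup_x|\widehat q(x,a)-\bar q(x,a)|=o_P(1)$; and $f(\bar q(x,a)\mid x,a)>0$ for $P_X$-almost every $x$ and $a\in\{0,1\}$. 4. Either $\sup_x|\widehat e(x)-e^*(x)|=o_P(1)$ for every fold, or $\sup_x|\widehat\rho(x,a)-\rho^*(x,a,\bar q)|=o_P(1)$ for every fold and both $a$ (with the signs listed above). Then the estimated bounds are pointwise valid: $$\pm\big(\widehat\tau^\pm(x)-\tau^\pm(x)\big)\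 \ge\ -o_P(1),$$ that is, for every $\varepsilon>0$, $\Pr\big(\pm(\widehat\tau^\pm(x)-\tau^\pm(x))<-\varepsilon\big)\to0$ as $n\to\infty$, the probability being over the samples and $x\sim\nu$. -/

import Mathlib

open MeasureTheory ProbabilityTheory Filter Topology
open scoped NNReal ENNReal

namespace BLearner

/-- Covariates take values in `ℝ^d`. -/
abbrev Cov (d : ℕ) : Type := EuclideanSpace ℝ (Fin d)

/-- An observation `Z = (X, A, Y)`; the treatment is `A = 1` exactly when the Boolean is `true`. -/
abbrev Obs (d : ℕ) : Type := Cov d × Bool × ℝ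

/-- The sign `±`: upper or lower bound. -/
inductive Side : Type
  | upper
  | lower

/-- The sign as a real number, `+1` or `-1`. -/
def Side.sgn : Side → ℝ
  | .upper => 1
  | .lower => -1

/-- The opposite sign `∓`. -/
def Side.opp : Side → Side
  | .upper => .lower
  | .lower => .upper

/-- `{u}_+ = max u 0` and `{u}_- = min u 0`. -/
def Side.part : Side → ℝ → ℝ
  | .upper, u => max u 0
  | .lower, u => min u 0

/-- The sign carried by the nuisances of arm `a` in the CATE bound `τ^±`:
`±` in the treated arm, `∓` in the control arm. -/
def Side.arm (s : Side) (a : Bool) : Side := if a then s else s.opp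

/-- The treatment indicator as a real number. -/
def ind (a : Bool) : ℝ := if a then 1 else 0

/-! ### The observed distribution -/

/-- The conditional law of `(A, Y)` given `X = x` when `(X, A, Y)` has law `P`. -/
noncomputable def condLaw {d : ℕ} (P : Measure (Obs d)) [IsProbabilityMeasure P] (x : Cov d) :
    Measure (Bool × ℝ) :=
  P.condKernel x

/-- The probability of treatment under a law `p` of `(A, Y)`. -/
noncomputable def treatProb (p : Measure (Bool × ℝ)) : ℝ := p.real {v | v.1 = true}

/-- The observed propensity score `e*(x) = P(A = 1 | X = x)`. -/
noncomputable def propensity {d : ℕ} (P : Measure (Obs d)) [IsProbabilityMeasure P]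
    (x : Cov d) : ℝ :=
  treatProb (condLaw P x)

/-- The conditional law of `Y` given `X = x`, `A = a`. -/
noncomputable def outcomeLaw {d : ℕ} (P : Measure (Obs d)) [IsProbabilityMeasure P]
    (x : Cov d) (a : Bool) : Measure ℝ :=
  (ProbabilityTheory.cond (condLaw P x) {v | v.1 = a}).map Prod.snd

/-- `f x a y` is a version of the conditional density `f(y | x, a)` of the outcome. -/
def IsCondDensity {d : ℕ} (P : Measure (Obs d)) [IsProbabilityMeasure P]
    (f : Cov d → Bool → ℝ → ℝ) : Prop :=
  ∀ᵐ x ∂P.fst, ∀ a : Bool, Measurable (f x a) ∧ (∀ y, 0 ≤ f x a y) ∧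
    outcomeLaw P x a = volume.withDensity (fun y => ENNReal.ofReal (f x a y))

/-- `α = Λ / (Λ + 1)`. -/
noncomputable def quantLevel (Λ : ℝ) : ℝ := Λ / (Λ + 1)

/-- The level of the quantile `q_±`: `α` for `+` and `1 - α` for `-`. -/
noncomputable def Side.level (Λ : ℝ) : Side → ℝ
  | .upper => quantLevel Λ
  | .lower => 1 - quantLevel Λ

/-- The conditional outcome quantile `q*_±(x, a) = inf {β | F(β | x, a) ≥ c}`. -/
noncomputable def condQuantile {d : ℕ} (Λ : ℝ) (P : Measure (Obs d)) [IsProbabilityMeasure P]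
    (s : Side) (x : Cov d) (a : Bool) : ℝ :=
  sInf {β : ℝ | s.level Λ ≤ (outcomeLaw P x a).real (Set.Iic β)}

/-- `H_±(z, q)`, where `q` is the value of the putative quantile at `(x, a)`. -/
noncomputable def cvarOutcome (Λ : ℝ) (s : Side) (y q : ℝ) : ℝ :=
  q + 1 / (1 - quantLevel Λ) * s.part (y - q)

/-- `R_±(z, q) = Λ⁻¹ y + (1 - Λ⁻¹) H_±(z, q)`. -/
noncomputable def modifiedOutcome (Λ : ℝ) (s : Side) (y q : ℝ) : ℝ :=
  Λ⁻¹ * y + (1 - Λ⁻¹) * cvarOutcome Λ s y q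

/-- `ρ*_±(x, a, q) = E[R_±(Z, q) | X = x, A = a]`, where `q` is the value of the putative quantile
at `(x, a)`. -/
noncomputable def modifiedRegression {d : ℕ} (Λ : ℝ) (P : Measure (Obs d))
    [IsProbabilityMeasure P] (s : Side) (x : Cov d) (a : Bool) (q : ℝ) : ℝ :=
  ∫ y, modifiedOutcome Λ s y q ∂(outcomeLaw P x a)

/-! ### The identified set and the sharp CATE bounds -/

/-- Values of the unobserved data `(A, Y(1), Y(0), U)` at a fixed covariate value, with
`U ∈ ℝ^k`. -/
abbrev Full (k : ℕ) : Type := Bool × ℝ × ℝ × Cov k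

/-- The unobserved confounder. -/
def confounder (k : ℕ) (v : Full k) : Cov k := v.2.2.2

/-- The σ-algebra generated by the unobserved confounder. -/
abbrev confounderSigma (k : ℕ) : MeasurableSpace (Full k) :=
  MeasurableSpace.comap (confounder k) inferInstance

theorem confounderSigma_le (k : ℕ) : confounderSigma k ≤ (inferInstance : MeasurableSpace (Full k)) :=
  Measurable.comap_le (by unfold confounder; fun_prop)

/-- The observed part `(A, Y)` of the full data, by consistency `Y = Y(A)`. -/
def coarsen (k : ℕ) (v : Full k) : Bool × ℝ := (v.1, if v.1 then v.2.1 else v.2.2.1)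

/-- A version of the full propensity score `Q(A = 1 | U)`. -/
noncomputable def fullPropensity {k : ℕ} (Q : Measure (Full k)) : Full k → ℝ :=
  condExp (confounderSigma k) Q (Set.indicator {v | v.1 = true} fun _ => (1 : ℝ))

/-- `Q`, a conditional law of `(A, Y(1), Y(0), U)` given `X = x`, cannot be ruled out by the
conditional law `p` of `(A, Y)` given `X = x` and the marginal sensitivity model with parameter
`Λ`: it induces `p`, treatment is unconfounded given `U`, and the odds of treatment given `U`
differ from the observed odds by a factor between `Λ⁻¹` and `Λ`. -/
structure Compatible (Λ : ℝ) (p : Measure (Bool × ℝ)) {k : ℕ} (Q : Measure (Full k))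
    [IsProbabilityMeasure Q] : Prop where
  observed : Q.map (coarsen k) = p
  unconfounded : CondIndepFun (confounderSigma k) (confounderSigma_le k)
    (fun v : Full k => v.1) (fun v : Full k => (v.2.1, v.2.2.1)) Q
  odds : ∀ᵐ v ∂Q, 0 < fullPropensity Q v ∧ fullPropensity Q v < 1 ∧
    Λ⁻¹ ≤ fullPropensity Q v / (1 - fullPropensity Q v) / (treatProb p / (1 - treatProb p)) ∧
    fullPropensity Q v / (1 - fullPropensity Q v) / (treatProb p / (1 - treatProb p)) ≤ Λ

/-- The identified set of values of `E[Y(1) - Y(0) | X = x]`, where `p` is the conditional law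
of `(A, Y)` given `X = x`; the dimension of the confounder is arbitrary. -/
def identifiedSet (Λ : ℝ) (p : Measure (Bool × ℝ)) : Set ℝ :=
  {t | ∃ (k : ℕ) (Q : Measure (Full k)) (_ : IsProbabilityMeasure Q), Compatible Λ p Q ∧
    Integrable (fun v : Full k => v.2.1 - v.2.2.1) Q ∧ t = ∫ v, (v.2.1 - v.2.2.1) ∂Q}

/-- The sharp CATE bounds `τ^+(x)` and `τ^-(x)`: the supremum and the infimum of the
identified set at `x`. -/
noncomputable def cateBound {d : ℕ} (Λ : ℝ) (P : Measure (Obs d)) [IsProbabilityMeasure P] :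
    Side → Cov d → ℝ
  | .upper, x => sSup (identifiedSet Λ (condLaw P x))
  | .lower, x => sInf (identifiedSet Λ (condLaw P x))

/-! ### Nuisances and pseudo-outcomes -/

/-- A set of (putative or estimated) nuisance functions: a propensity score, conditional quantiles
`q_±(x, a)` and modified outcome regressions `ρ_±(x, a)`. -/
structure Nuisance (d : ℕ) where
  e : Cov d → ℝ
  q : Side → Cov d → Bool → ℝ
  ρ : Side → Cov d → Bool → ℝ

/-- The true nuisances `η*`. -/
noncomputable def trueNuisance {d : ℕ} (Λ : ℝ) (P : Measure (Obs d)) [IsProbabilityMeasure P] :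
    Nuisance d where
  e := propensity P
  q := condQuantile Λ P
  ρ s x a := modifiedRegression Λ P s x a (condQuantile Λ P s x a)

/-- The convex combination `(1 - t) η + t η'`. -/
def Nuisance.mix {d : ℕ} (t : ℝ) (η η' : Nuisance d) : Nuisance d where
  e x := (1 - t) * η.e x + t * η'.e x
  q s x a := (1 - t) * η.q s x a + t * η'.q s x a
  ρ s x a := (1 - t) * η.ρ s x a + t * η'.ρ s x a

/-- The pseudo-outcome `φ_1^±(Z, η)` for `Y^±(x, 1)`. -/
noncomputable def pseudoTreated {d : ℕ} (Λ : ℝ) (s : Side) (z : Obs d) (η : Nuisance d) : ℝ :=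
  ind z.2.1 * z.2.2 + (1 - ind z.2.1) * η.ρ s z.1 true
    + (1 - η.e z.1) * ind z.2.1 / η.e z.1
      * (modifiedOutcome Λ s z.2.2 (η.q s z.1 true) - η.ρ s z.1 true)

/-- The pseudo-outcome `φ_0^±(Z, η)` for `Y^±(x, 0)`. -/
noncomputable def pseudoControl {d : ℕ} (Λ : ℝ) (s : Side) (z : Obs d) (η : Nuisance d) : ℝ :=
  (1 - ind z.2.1) * z.2.2 + ind z.2.1 * η.ρ s z.1 false
    + η.e z.1 * (1 - ind z.2.1) / (1 - η.e z.1)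
      * (modifiedOutcome Λ s z.2.2 (η.q s z.1 false) - η.ρ s z.1 false)

/-- The pseudo-outcome `φ_τ^± = φ_1^± - φ_0^∓` for the CATE bound. -/
noncomputable def pseudoCate {d : ℕ} (Λ : ℝ) (s : Side) (z : Obs d) (η : Nuisance d) : ℝ :=
  pseudoTreated Λ s z η - pseudoControl Λ s.opp z η

/-! ### The two-stage estimator

The observations `Z_i`, `i < n`, are i.i.d. with law `P`; observation `i` belongs to the fold
`i mod K`. An auxiliary sample (or external randomization) with values in `S` and law `γ n`,
independent of the observations, may be used by the nuisance estimators and the weights. -/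

/-- A training sample for fold `k`: observations of the folds other than `k`. -/
abbrev Training (d n K k : ℕ) : Type := {j : Fin n // (j : ℕ) % K ≠ k} → Obs d

/-- The observations outside fold `k`. -/
def training {d n : ℕ} (K k : ℕ) (z : Fin n → Obs d) : Training d n K k := fun j => z j.1

/-- The nuisance estimators: for each sample size `n` and fold `k`, a map from the auxiliary sample
and the training sample of the fold to nuisances. -/
abbrev NuisanceEst (S : Type*) (d K : ℕ) : Type _ :=
  ∀ n k : ℕ, S → Training d n K k → Nuisance d

/-- The smoother weights `w_i(x)`, `i < n`, computed from the auxiliary sample and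
the covariates `X_1, …, X_n`. -/
abbrev Weights (S : Type*) (d : ℕ) : Type _ :=
  ∀ n : ℕ, Fin n → S → (Fin n → Cov d) → Cov d → ℝ

/-- Joint measurability of the nuisance estimators in the data and the argument. -/
structure NuisanceEst.IsMeasurable {S : Type*} [MeasurableSpace S] {d K : ℕ}
    (η : NuisanceEst S d K) : Prop where
  e : ∀ n k, Measurable fun p : S × Training d n K k × Cov d => (η n k p.1 p.2.1).e p.2.2
  q : ∀ n k s a, Measurable
    fun p : S × Training d n K k × Cov d => (η n k p.1 p.2.1).q s p.2.2 a
  ρ : ∀ n k s a, Measurable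
    fun p : S × Training d n K k × Cov d => (η n k p.1 p.2.1).ρ s p.2.2 a

/-- Joint measurability of the weights in the data and the argument. -/
def Weights.IsMeasurable {S : Type*} [MeasurableSpace S] {d : ℕ} (w : Weights S d) : Prop :=
  ∀ n i, Measurable fun p : S × (Fin n → Cov d) × Cov d => w n i p.1 p.2.1 p.2.2

/-- The joint law of the auxiliary sample and the `n` i.i.d. observations. -/
noncomputable def sampleLaw {S : Type*} [MeasurableSpace S] {d : ℕ} (γ : ℕ → Measure S)
    (P : Measure (Obs d)) (n : ℕ) : Measure (S × (Fin n → Obs d)) :=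
  (γ n).prod (Measure.pi fun _ : Fin n => P)

/-- The joint law of the sample and an evaluation point with law `ν`, independent of the sample. -/
noncomputable def evalLaw {S : Type*} [MeasurableSpace S] {d : ℕ} (γ : ℕ → Measure S)
    (P : Measure (Obs d)) (ν : Measure (Cov d)) (n : ℕ) :
    Measure ((S × (Fin n → Obs d)) × Cov d) :=
  (sampleLaw γ P n).prod ν

/-- The nuisances estimated for fold `k` from a sample. -/
def NuisanceEst.fit {S : Type*} {d K : ℕ} (η : NuisanceEst S d K) (n k : ℕ)
    (D : S × (Fin n → Obs d)) : Nuisance d :=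
  η n k D.1 (training K k D.2)

/-- The normalized weight `w_i(x) / n`. -/
noncomputable def Weights.normalized {S : Type*} {d : ℕ} (w : Weights S d) {n : ℕ} (i : Fin n)
    (D : S × (Fin n → Obs d)) (x : Cov d) : ℝ :=
  w n i D.1 (fun j => (D.2 j).1) x / n

/-- The estimated bound `τ̂^±(x) = n⁻¹ ∑ w_i(x) φ_τ^±(Z_i, η̂^{(k(i))})`, with `k(i)` the fold
of observation `i`. -/
noncomputable def cateEstimator {S : Type*} {d K : ℕ} (Λ : ℝ) (η : NuisanceEst S d K)
    (w : Weights S d) (s : Side) {n : ℕ} (D : S × (Fin n → Obs d)) (x : Cov d) : ℝ :=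
  (1 / (n : ℝ)) * ∑ i : Fin n, w n i D.1 (fun j => (D.2 j).1) x
    * pseudoCate Λ s (D.2 i) (η.fit n ((i : ℕ) % K) D)

/-! ### Conditions -/

/-- The boundedness conditions for the bound with sign `s`, uniformly over sample sizes and folds:
overlap for `e*` and `ê`, and boundedness of `Y` and, along the segment from `η*` to `η̂`, of
the quantiles, of the modified regressions and of the outcome density at the quantiles. -/
def BoundedNuisances {S : Type*} [MeasurableSpace S] {d K : ℕ} (Λ : ℝ) (P : Measure (Obs d))
    [IsProbabilityMeasure P] (f : Cov d → Bool → ℝ → ℝ) (γ : ℕ → Measure S)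
    (η : NuisanceEst S d K) (s : Side) : Prop :=
  ∃ ε : ℝ, 0 < ε ∧ ∃ C : ℝ,
    (∀ᵐ x ∂P.fst, ε ≤ propensity P x ∧ propensity P x ≤ 1 - ε) ∧
    (∀ᵐ z ∂P, |z.2.2| ≤ C) ∧
    ∀ n k : ℕ, k < K → ∀ᵐ D ∂(sampleLaw γ P n), ∀ᵐ x ∂P.fst,
      (ε ≤ (η.fit n k D).e x ∧ (η.fit n k D).e x ≤ 1 - ε) ∧
      ∀ t ∈ Set.Icc (0 : ℝ) 1, ∀ a : Bool,
        |((trueNuisance Λ P).mix t (η.fit n k D)).q (s.arm a) x a| ≤ C ∧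
        |((trueNuisance Λ P).mix t (η.fit n k D)).ρ (s.arm a) x a| ≤ C ∧
        f x a (((trueNuisance Λ P).mix t (η.fit n k D)).q (s.arm a) x a) ≤ C

/-- Uniform consistency: the (essential) supremum over `x` of `|ĝ_n(x) - g(x)|` tends to `0` in
probability. -/
def UnifConsistent {S : Type*} [MeasurableSpace S] {d : ℕ} (P : Measure (Obs d))
    (γ : ℕ → Measure S) (ghat : ∀ n : ℕ, S × (Fin n → Obs d) → Cov d → ℝ) (g : Cov d → ℝ) :
    Prop :=
  ∀ ε : ℝ, 0 < ε →
    Tendsto (fun n => sampleLaw γ P n {D | ¬ ∀ᵐ x ∂P.fst, |ghat n D x - g x| ≤ ε}) atTop (𝓝 0)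

/-- The requirements of Stone's theorem on universal consistency for the weights `w_i(x) / n`, at an
evaluation point with law `ν` (for Stone, `ν` is the law of `X`). -/
structure StoneConditions {S : Type*} [MeasurableSpace S] {d : ℕ} (P : Measure (Obs d))
    (γ : ℕ → Measure S) (ν : Measure (Cov d)) (w : Weights S d) : Prop where
  dominated : ∃ C : ℝ≥0, ∀ (n : ℕ) (h : Cov d → ℝ≥0∞), Measurable h →
    ∫⁻ p, ∑ i : Fin n, ENNReal.ofReal |w.normalized i p.1 p.2| * h (p.1.2 i).1
      ∂(evalLaw γ P ν n) ≤ C * ∫⁻ x, h x ∂P.fst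
  sum_abs_bounded : ∃ M : ℝ, ∀ n : ℕ, ∀ᵐ p ∂(evalLaw γ P ν n),
    ∑ i : Fin n, |w.normalized i p.1 p.2| ≤ M
  localized : ∀ r : ℝ, 0 < r → ∀ ε : ℝ, 0 < ε →
    Tendsto (fun n => evalLaw γ P ν n {p | ε < ∑ i : Fin n,
      Set.indicator {u : Cov d | r < ‖u - p.2‖} (fun _ => |w.normalized i p.1 p.2|) (p.1.2 i).1})
      atTop (𝓝 0)
  sum_tendsto_one : ∀ ε : ℝ, 0 < ε →
    Tendsto (fun n => evalLaw γ P ν n {p | ε < |(∑ i : Fin n, w.normalized i p.1 p.2) - 1|})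
      atTop (𝓝 0)
  max_tendsto_zero : ∀ ε : ℝ, 0 < ε →
    Tendsto (fun n => evalLaw γ P ν n {p | ∃ i : Fin n, ε < |w.normalized i p.1 p.2|})
      atTop (𝓝 0)

end BLearner

namespace BLearner

/-! The estimator converges to a limit `g(x)` that may differ from the sharp bound, but only on the
safe side of it.

Safe side. Under a law in the identified set, unconfoundedness given `U` turns the unobserved half
of `E[Y(a)]` into an integral of `w Y` over the observed arm, where `w` is the conditional odds of
the other arm given `U`. Two facts are known about `w`: its total mass, and that after division by
the observed odds it lies in `[Λ⁻¹, Λ]`. For any number `q`, split `w Y = w (Y - q) + q w`. The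
second term has a known integral, and the first is extremal pointwise when the weight is `Λ` or
`Λ⁻¹` according to the sign of `Y - q`; this extreme value is what `R_±(Y, q)` encodes. So every
putative quantile, right or wrong, bounds the whole identified set (`sgn_mul_integral_le`,
`sgn_mul_le_of_mem_identifiedSet`). Take for `g` the bound obtained from the limits `q̄`.

Limit. By `cateEstimator_eq`, the error with respect to `g(x)` is a sum of three terms. The noise is
centred given everything except the treatment and outcome of one observation of the fold; its
variance is at most a constant times `E ∑ W_i²`, which vanishes because `∑ W_i² ≤ max |W_i| ∑ |W_i|`
(`tendsto_noise`). The bias is a Lipschitz term in the quantile error plus a product of the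
propensity error and the regression error (`abs_meanArm_sub_armBound_le`), so consistency of one of
the two suffices. The smoothing error of `g` vanishes by Stone's argument
(`tendsto_weighted_average`); the weight conditions themselves force the law of the evaluation point
to be dominated by `P_X` (`evalPoint_le`), so almost sure facts about the covariates hold there too.
-/

/-! ### The sensitivity bound on one potential outcome. -/

/-- Given `m`, the law of `Y` is the same in both arms, so the arms share the mass of `{Y ∈ B}` in
the ratio `π : 1 - π`. Integrating over `m` gives the reweighting by the odds. The bound `c` on the
odds provides integrability. -/
theorem map_restrict_compl_eq_withDensity {Ω : Type*} {m mΩ : MeasurableSpace Ω}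
    [StandardBorelSpace Ω] (hm : m ≤ mΩ) (Q : Measure Ω) [IsProbabilityMeasure Q] {A : Ω → Bool}
    {Y : Ω → ℝ} (hA : Measurable A) (hY : Measurable Y) (h : CondIndepFun m hm A Y Q) (a : Bool)
    (c : ℝ) (hπ : ∀ᵐ ω ∂Q, 0 < (Q⟦A ⁻¹' {a} | m⟧) ω ∧ (Q⟦A ⁻¹' {a} | m⟧) ω ≤ 1 ∧
      (1 - (Q⟦A ⁻¹' {a} | m⟧) ω) / (Q⟦A ⁻¹' {a} | m⟧) ω ≤ c) :
    (Q.restrict (A ⁻¹' {!a})).map Y = ((Q.restrict (A ⁻¹' {a})).withDensity fun ω =>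
      ENNReal.ofReal ((1 - (Q⟦A ⁻¹' {a} | m⟧) ω) / (Q⟦A ⁻¹' {a} | m⟧) ω)).map Y := by
  ext B hB
  set π := Q⟦A ⁻¹' {a} | m⟧ with hπdef
  set w : Ω → ℝ := fun ω => (1 - π ω) / π ω with hw
  have hπm : StronglyMeasurable[m] π := stronglyMeasurable_condExp
  have hwm : StronglyMeasurable[m] w :=
    ((measurable_const.sub hπm.measurable).div hπm.measurable).stronglyMeasurable
  have hAa : ∀ b, MeasurableSet (A ⁻¹' {b}) := fun b => hA (measurableSet_singleton b)
  have hYB : MeasurableSet (Y ⁻¹' B) := hY hB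
  have key := (condIndepFun_iff_condExp_inter_preimage_eq_mul hA hY).1 h
  have hsum : (Q⟦A ⁻¹' {!a} | m⟧) =ᵐ[Q] fun ω => 1 - π ω := by
    have h1 : (A ⁻¹' {!a}).indicator (fun _ => (1 : ℝ)) =
        (fun _ => (1 : ℝ)) - (A ⁻¹' {a}).indicator (fun _ => (1 : ℝ)) := by
      ext ω
      by_cases hh : A ω = a
      · simp [Set.indicator, hh]
      · have : A ω = !a := by cases a <;> simp_all
        simp [Set.indicator, this]
    rw [h1]
    refine (condExp_sub (integrable_const 1) ((integrable_const 1).indicator (hAa a)) m).trans ?_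
    rw [condExp_const hm]
    rfl
  have hwb : ∀ᵐ ω ∂Q, ‖w ω‖ ≤ c := by
    filter_upwards [hπ] with ω hω
    rw [Real.norm_eq_abs, abs_of_nonneg]
    · exact hω.2.2
    · exact div_nonneg (by linarith [hω.2.1]) hω.1.le
  set ia : Ω → ℝ := (A ⁻¹' {a} ∩ Y ⁻¹' B).indicator fun _ => (1 : ℝ) with hia
  have hiaint : Integrable ia Q := (integrable_const 1).indicator ((hAa a).inter hYB)
  have hwia : Integrable (w * ia) Q :=
    hiaint.bdd_mul (c := c) (hwm.mono hm).aestronglyMeasurable hwb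
  have e1 : ∫ ω, (w * ia) ω ∂Q = Q.real (A ⁻¹' {!a} ∩ Y ⁻¹' B) := by
    rw [← integral_condExp hm (f := w * ia)]
    have : Q.real (A ⁻¹' {!a} ∩ Y ⁻¹' B) =
        ∫ ω, (A ⁻¹' {!a} ∩ Y ⁻¹' B).indicator (fun _ => (1 : ℝ)) ω ∂Q := by
      rw [integral_indicator ((hAa _).inter hYB)]; simp
    rw [this, ← integral_condExp hm
      (f := (A ⁻¹' {!a} ∩ Y ⁻¹' B).indicator (fun _ => (1 : ℝ)))]
    -- The odds are `m`-measurable and can be pulled out of the conditional expectation; conditional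
    -- independence then reduces the claim to `w * (π * P(Y ∈ B | m)) = (1 - π) * P(Y ∈ B | m)`.
    refine integral_congr_ae ?_
    filter_upwards [condExp_mul_of_stronglyMeasurable_left hwm hwia hiaint,
      key {a} B (measurableSet_singleton a) hB, key {!a} B (measurableSet_singleton _) hB, hsum, hπ]
      with ω h1 h2 h3 h4 h5
    rw [h1, h3, h4]
    simp only [Pi.mul_apply]
    rw [h2, ← hπdef, hw]
    have : π ω ≠ 0 := h5.1.ne'
    field_simp
  rw [Measure.map_apply hY hB, Measure.map_apply hY hB, withDensity_apply _ hYB,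
    Measure.restrict_apply hYB, Measure.restrict_restrict hYB, Set.inter_comm (Y ⁻¹' B),
    Set.inter_comm (Y ⁻¹' B)]
  rw [← ENNReal.ofReal_toReal (measure_ne_top Q (A ⁻¹' {!a} ∩ Y ⁻¹' B)), ← measureReal_def, ← e1]
  have e2 : w * ia = (A ⁻¹' {a} ∩ Y ⁻¹' B).indicator w := by
    ext ω
    simp [hia, Set.indicator]
  rw [e2, integral_indicator ((hAa a).inter hYB)]
  rw [e2, integrable_indicator_iff ((hAa a).inter hYB)] at hwia
  rw [ofReal_integral_eq_lintegral_ofReal hwia]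
  refine ae_restrict_of_ae ?_
  filter_upwards [hπ] with ω hω
  exact div_nonneg (by linarith [hω.2.1]) hω.1.le

/-- Since `(1 - Λ⁻¹) / (1 - α) = Λ - Λ⁻¹`, the right side is `Λ⁻¹ u + (Λ - Λ⁻¹) {u}_±` with `u = y -
q`: weight `Λ` where `u` has the favourable sign and `Λ⁻¹` elsewhere, the extreme choice of `r`.
Nothing is asked of `q`, which is why wrong quantiles still give valid bounds. -/
theorem sgn_mul_part_bound {Λ : ℝ} (hΛ : 1 ≤ Λ) (s : Side) {r : ℝ} (h1 : Λ⁻¹ ≤ r) (h2 : r ≤ Λ)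
    (y q : ℝ) : s.sgn * (r * (y - q)) ≤ s.sgn * (modifiedOutcome Λ s y q - q) := by
  have hΛ0 : 0 < Λ := by linarith
  have e : (1 : ℝ) / (1 - quantLevel Λ) = Λ + 1 := by
    unfold quantLevel; field_simp; ring
  have e' : (1 - Λ⁻¹) * (Λ + 1) = Λ - Λ⁻¹ := by field_simp; ring
  have e2 : modifiedOutcome Λ s y q - q = Λ⁻¹ * (y - q) + (Λ - Λ⁻¹) * s.part (y - q) := by
    unfold modifiedOutcome cvarOutcome
    rw [e, ← e']; ring
  rw [e2]
  cases s
  · simp only [Side.sgn, Side.part, one_mul]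
    rcases le_total (y - q) 0 with h | h
    · rw [max_eq_right h]; nlinarith
    · rw [max_eq_left h]; nlinarith
  · simp only [Side.sgn, Side.part]
    rcases le_total (y - q) 0 with h | h
    · rw [min_eq_left h]; nlinarith
    · rw [min_eq_right h]; nlinarith

theorem measurable_modifiedOutcome (Λ : ℝ) (s : Side) :
    Measurable fun p : ℝ × ℝ => modifiedOutcome Λ s p.1 p.2 := by
  cases s <;> (unfold modifiedOutcome cvarOutcome Side.part; fun_prop)

/-- The slope in `q` is at most `(1 - Λ⁻¹) (1 + 1 / (1 - α))`, where `1 / (1 - α) = Λ + 1` and `1 -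
Λ⁻¹ ≤ 1`. -/
theorem lipschitz_modifiedOutcome {Λ : ℝ} (hΛ : 1 ≤ Λ) (s : Side) (y q q' : ℝ) :
    |modifiedOutcome Λ s y q - modifiedOutcome Λ s y q'| ≤ (Λ + 2) * |q - q'| := by
  have hΛ0 : 0 < Λ := by linarith
  have e : (1 : ℝ) / (1 - quantLevel Λ) = Λ + 1 := by
    unfold quantLevel; field_simp; ring
  have h1 : 0 ≤ 1 - Λ⁻¹ := by linarith [inv_le_one_of_one_le₀ hΛ]
  have h2 : 1 - Λ⁻¹ ≤ 1 := by linarith [inv_pos.2 hΛ0]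
  have hp : |s.part (y - q) - s.part (y - q')| ≤ |q - q'| := by
    have : |(y - q) - (y - q')| = |q - q'| := by rw [abs_sub_comm]; ring_nf
    rw [← this]
    cases s
    · exact (abs_max_sub_max_le_abs _ _ _)
    · exact (abs_min_sub_min_le_max _ _ _ _).trans (by simp)
  have : modifiedOutcome Λ s y q - modifiedOutcome Λ s y q' =
      (1 - Λ⁻¹) * ((q - q') + (Λ + 1) * (s.part (y - q) - s.part (y - q'))) := by
    unfold modifiedOutcome cvarOutcome
    rw [e]; ring
  rw [this, abs_mul, abs_of_nonneg h1]
  calc (1 - Λ⁻¹) * |(q - q') + (Λ + 1) * (s.part (y - q) - s.part (y - q'))|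
      ≤ 1 * (|q - q'| + (Λ + 1) * |q - q'|) := by
        gcongr
        refine (abs_add_le _ _).trans ?_
        rw [abs_mul, abs_of_pos (by linarith : 0 < Λ + 1)]
        gcongr
    _ = _ := by ring

/-- At `q = y` the modified outcome is `y` itself, so the Lipschitz bound with `|q - y| ≤ 2C` gives
`(Λ + 2) * 2C + C`. -/
theorem abs_modifiedOutcome_le {Λ : ℝ} (hΛ : 1 ≤ Λ) (s : Side) {y q C : ℝ} (hy : |y| ≤ C)
    (hq : |q| ≤ C) : |modifiedOutcome Λ s y q| ≤ (2 * Λ + 5) * C := by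
  have h := lipschitz_modifiedOutcome hΛ s y q y
  have h0 : modifiedOutcome Λ s y y = y := by
    cases s <;> simp [modifiedOutcome, cvarOutcome, Side.part] <;> ring
  have h3 : |q - y| ≤ C + C := (abs_sub _ _).trans (add_le_add hq hy)
  rw [h0] at h
  calc |modifiedOutcome Λ s y q| = |(modifiedOutcome Λ s y q - y) + y| := by ring_nf
    _ ≤ (Λ + 2) * (C + C) + C := (abs_add_le _ _).trans (by
        refine add_le_add (h.trans ?_) hy
        gcongr)
    _ = _ := by ring

/-- The bound on the mean of a potential outcome under the marginal sensitivity model. -/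
theorem sgn_mul_integral_le {Ω : Type*} {m mΩ : MeasurableSpace Ω}
    [StandardBorelSpace Ω] (hm : m ≤ mΩ) (Q : Measure Ω) [IsProbabilityMeasure Q] {A : Ω → Bool}
    {Y : Ω → ℝ} (hA : Measurable A) (hY : Measurable Y) (h : CondIndepFun m hm A Y Q) (a : Bool)
    {Λ : ℝ} (hΛ : 1 ≤ Λ) (s : Side) {e : ℝ} (he : Q.real (A ⁻¹' {a}) = e) (he0 : 0 < e)
    (he1 : e < 1) (hπ : ∀ᵐ ω ∂Q, 0 < (Q⟦A ⁻¹' {a} | m⟧) ω ∧ (Q⟦A ⁻¹' {a} | m⟧) ω < 1 ∧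
      Λ⁻¹ ≤ (1 - (Q⟦A ⁻¹' {a} | m⟧) ω) / (Q⟦A ⁻¹' {a} | m⟧) ω * (e / (1 - e)) ∧
      (1 - (Q⟦A ⁻¹' {a} | m⟧) ω) / (Q⟦A ⁻¹' {a} | m⟧) ω * (e / (1 - e)) ≤ Λ)
    {C : ℝ} (hC : ∀ᵐ ω ∂(Q.restrict (A ⁻¹' {a})), |Y ω| ≤ C) (q : ℝ) :
    Integrable Y Q ∧ s.sgn * ∫ ω, Y ω ∂Q ≤ s.sgn * (∫ ω in A ⁻¹' {a}, Y ω ∂Q +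
      (1 - e) / e * ∫ ω in A ⁻¹' {a}, modifiedOutcome Λ s (Y ω) q ∂Q) := by
  have hodds : 0 < e / (1 - e) := div_pos he0 (by linarith)
  have hmap := map_restrict_compl_eq_withDensity hm Q hA hY h a (Λ / (e / (1 - e))) (by
    filter_upwards [hπ] with ω hω
    exact ⟨hω.1, hω.2.1.le, by rw [le_div_iff₀ hodds]; exact hω.2.2.2⟩)
  set π := Q⟦A ⁻¹' {a} | m⟧ with hπdef
  set w : Ω → ℝ := fun ω => (1 - π ω) / π ω with hw
  have hπm : Measurable π := (stronglyMeasurable_condExp.mono hm).measurable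
  have hwm : Measurable w := (measurable_const.sub hπm).div hπm
  have hAa : ∀ b, MeasurableSet (A ⁻¹' {b}) := fun b => hA (measurableSet_singleton b)
  have hcompl : A ⁻¹' {!a} = (A ⁻¹' {a})ᶜ := by
    ext ω; simp only [Set.mem_preimage, Set.mem_singleton_iff, Set.mem_compl_iff]
    cases a <;> cases A ω <;> simp
  have hw0 : ∀ᵐ ω ∂(Q.restrict (A ⁻¹' {a})), 0 ≤ w ω := by
    filter_upwards [ae_restrict_of_ae hπ] with ω hω
    exact div_nonneg (by linarith [hω.2.1]) hω.1.le
  have hwb : ∀ᵐ ω ∂(Q.restrict (A ⁻¹' {a})), ‖w ω‖ ≤ Λ / (e / (1 - e)) := by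
    filter_upwards [hw0, ae_restrict_of_ae hπ] with ω h0 hω
    rw [Real.norm_eq_abs, abs_of_nonneg h0, le_div_iff₀ hodds]; exact hω.2.2.2
  have hCset : MeasurableSet {y : ℝ | |y| ≤ C} := measurableSet_le (by fun_prop) (by fun_prop)
  -- The data bound `Y` only where it is observed; the bound reaches the other arm because its law
  -- there is absolutely continuous with respect to the observed one.
  have hC' : ∀ᵐ ω ∂(Q.restrict (A ⁻¹' {!a})), |Y ω| ≤ C := by
    have : ∀ᵐ y ∂((Q.restrict (A ⁻¹' {!a})).map Y), |y| ≤ C := by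
      rw [hmap, ae_map_iff hY.aemeasurable hCset]
      exact (withDensity_absolutelyContinuous _ _).ae_le hC
    exact (ae_map_iff hY.aemeasurable hCset).1 this
  have hYa : IntegrableOn Y (A ⁻¹' {a}) Q :=
    Integrable.of_bound hY.aestronglyMeasurable C (by simpa using hC)
  have hYc : IntegrableOn Y (A ⁻¹' {!a}) Q :=
    Integrable.of_bound hY.aestronglyMeasurable C (by simpa using hC')
  have hYint : Integrable Y Q := by
    rw [← integrableOn_univ, ← Set.union_compl_self (A ⁻¹' {a}), ← hcompl]
    exact hYa.union hYc
  refine ⟨hYint, ?_⟩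
  have hwint : IntegrableOn w (A ⁻¹' {a}) Q :=
    Integrable.of_bound hwm.aestronglyMeasurable _ hwb
  have hwY : IntegrableOn (fun ω => w ω * Y ω) (A ⁻¹' {a}) Q :=
    hYa.bdd_mul hwm.aestronglyMeasurable hwb
  have transfer : ∀ g : ℝ → ℝ, Measurable g → ∫ ω in A ⁻¹' {!a}, g (Y ω) ∂Q =
      ∫ ω in A ⁻¹' {a}, w ω * g (Y ω) ∂Q := by
    intro g hg
    rw [← integral_map (φ := Y) hY.aemeasurable hg.aestronglyMeasurable, hmap,
      integral_map hY.aemeasurable hg.aestronglyMeasurable,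
      integral_withDensity_eq_integral_toReal_smul (by fun_prop) (by simp)]
    refine integral_congr_ae ?_
    filter_upwards [hw0] with ω hω
    rw [ENNReal.toReal_ofReal hω, smul_eq_mul]
  -- The total weight does not depend on the unknown law, so subtracting `q * w` costs a known
  -- constant. This is what frees `q`.
  have hmassc : ∫ ω in A ⁻¹' {a}, w ω ∂Q = 1 - e := by
    have := transfer (fun _ => 1) measurable_const
    simp only [mul_one, integral_const, smul_eq_mul, measureReal_restrict_apply_univ] at this
    rw [← this, hcompl, measureReal_compl (hAa a), he]; simp
  have hmass : ∫ _ in A ⁻¹' {a}, q ∂Q = q * e := by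
    simp [he, mul_comm]
  have hsplit : ∫ ω, Y ω ∂Q = ∫ ω in A ⁻¹' {a}, Y ω ∂Q + ∫ ω in A ⁻¹' {a}, w ω * Y ω ∂Q := by
    rw [← integral_add_compl (hAa a) hYint, ← hcompl, transfer (fun y => y) measurable_id]
  have hRint : IntegrableOn (fun ω => modifiedOutcome Λ s (Y ω) q) (A ⁻¹' {a}) Q := by
    refine Integrable.of_bound ((measurable_modifiedOutcome Λ s).comp
      (hY.prodMk measurable_const)).aestronglyMeasurable ((2 * Λ + 5) * max C |q|) ?_
    filter_upwards [hC] with ω hω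
    exact abs_modifiedOutcome_le hΛ s (hω.trans (le_max_left _ _)) (le_max_right _ _)
  -- The pointwise bound is applied with `r = w * (e / (1 - e))`, the normalized odds ratio, and
  -- scaled back by `(1 - e) / e`.
  have hmain : ∫ ω in A ⁻¹' {a}, s.sgn * (w ω * Y ω - q * w ω) ∂Q ≤
      ∫ ω in A ⁻¹' {a}, (1 - e) / e * (s.sgn * (modifiedOutcome Λ s (Y ω) q - q)) ∂Q := by
    refine integral_mono_ae ((hwY.sub (hwint.const_mul q)).const_mul _)
      (((hRint.sub (integrable_const q)).const_mul _).const_mul _) ?_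
    filter_upwards [ae_restrict_of_ae hπ] with ω hω
    have := sgn_mul_part_bound hΛ s hω.2.2.1 hω.2.2.2 (Y ω) q
    have h3 : 0 < (1 - e) / e := div_pos (by linarith) he0
    have h4 : (1 - e) / e * (e / (1 - e)) = 1 := by
      have : 1 - e ≠ 0 := by linarith
      field_simp
    calc s.sgn * (w ω * Y ω - q * w ω)
        = ((1 - e) / e * (e / (1 - e))) * (s.sgn * (w ω * Y ω - q * w ω)) := by rw [h4, one_mul]
      _ = (1 - e) / e * (s.sgn * (w ω * (e / (1 - e)) * (Y ω - q))) := by ring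
      _ ≤ _ := by gcongr
  rw [integral_const_mul, integral_sub hwY (hwint.const_mul q), integral_const_mul, hmassc,
    integral_const_mul, integral_const_mul, integral_sub hRint (integrable_const q), hmass] at hmain
  rw [hsplit]
  have h5 : (1 - e) / e * (s.sgn * (∫ ω in A ⁻¹' {a}, modifiedOutcome Λ s (Y ω) q ∂Q - q * e)) =
      s.sgn * ((1 - e) / e * ∫ ω in A ⁻¹' {a}, modifiedOutcome Λ s (Y ω) q ∂Q)
        - s.sgn * (q * (1 - e)) := by
    field_simp
  rw [h5] at hmain
  linarith

/-! ### Outer bounds on the identified set. -/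

theorem Side.sgn_opp (s : Side) : s.opp.sgn = -s.sgn := by cases s <;> simp [Side.opp, Side.sgn]

theorem measurableSet_arm (a : Bool) : MeasurableSet {v : Bool × ℝ | v.1 = a} :=
  measurable_fst (measurableSet_singleton a)

/-- The probability of arm `a` under a law of `(A, Y)`. -/
noncomputable def armProb (p : Measure (Bool × ℝ)) (a : Bool) : ℝ := p.real {v | v.1 = a}

theorem armProb_false (p : Measure (Bool × ℝ)) [IsProbabilityMeasure p] :
    armProb p false = 1 - treatProb p := by
  unfold armProb treatProb
  rw [← probReal_compl_eq_one_sub (measurableSet_arm true)]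
  congr 1
  ext v
  simp

theorem armProb_pos {p : Measure (Bool × ℝ)} [IsProbabilityMeasure p] (h0 : 0 < treatProb p)
    (h1 : treatProb p < 1) (a : Bool) : 0 < armProb p a := by
  cases a
  · rw [armProb_false]; linarith
  · exact h0

theorem armProb_lt_one {p : Measure (Bool × ℝ)} [IsProbabilityMeasure p] (h0 : 0 < treatProb p)
    (h1 : treatProb p < 1) (a : Bool) : armProb p a < 1 := by
  cases a
  · rw [armProb_false]; linarith
  · exact h1

/-- The integral of `R_±` over arm `a`. -/
noncomputable def armModified (Λ : ℝ) (p : Measure (Bool × ℝ)) (s : Side) (a : Bool) (q : ℝ) : ℝ :=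
  ∫ v in {v | v.1 = a}, modifiedOutcome Λ s v.2 q ∂p

/-- The bound on `E[Y(a)]` obtained from a putative quantile `q`. -/
noncomputable def armBound (Λ : ℝ) (p : Measure (Bool × ℝ)) (s : Side) (a : Bool) (q : ℝ) : ℝ :=
  ∫ v in {v | v.1 = a}, v.2 ∂p + (1 - armProb p a) / armProb p a * armModified Λ p s a q

/-- The bound on the CATE obtained from putative quantiles `q`. -/
noncomputable def putativeBound (Λ : ℝ) (p : Measure (Bool × ℝ)) (s : Side) (q : Bool → ℝ) : ℝ :=
  armBound Λ p (s.arm true) true (q true) - armBound Λ p (s.arm false) false (q false)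

theorem measurable_coarsen (k : ℕ) : Measurable (coarsen k) :=
  measurable_fst.prodMk (Measurable.ite (measurable_fst (measurableSet_singleton true))
    (by fun_prop) (by fun_prop))

theorem setIntegral_of_compatible {Λ : ℝ} {p : Measure (Bool × ℝ)} {k : ℕ} {Q : Measure (Full k)}
    [IsProbabilityMeasure Q] (h : Compatible Λ p Q) (a : Bool) {g : ℝ → ℝ} (hg : Measurable g) :
    ∫ v in {v | v.1 = a}, g v.2 ∂p =
      ∫ v in (fun v : Full k => v.1) ⁻¹' {a}, g (if a then v.2.1 else v.2.2.1) ∂Q := by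
  rw [← h.observed, setIntegral_map (f := fun v : Bool × ℝ => g v.2) (measurableSet_arm a)
    (hg.comp measurable_snd).aestronglyMeasurable (measurable_coarsen k).aemeasurable]
  refine setIntegral_congr_fun (measurable_fst (measurableSet_singleton a)) ?_
  intro v hv
  have hv' : v.1 = a := hv
  simp [coarsen, hv']

/-- The one-arm bound is used with side `s` for `Y(1)` and the opposite side for `Y(0)`. It speaks
of the odds of the other arm: for the control arm this is the ratio in `Compatible`, for the treated
arm its inverse, and `[Λ⁻¹, Λ]` is stable under inversion. -/
theorem sgn_mul_le_of_mem_identifiedSet {Λ : ℝ} (hΛ : 1 ≤ Λ) {p : Measure (Bool × ℝ)}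
    [IsProbabilityMeasure p] (h0 : 0 < treatProb p) (h1 : treatProb p < 1) {C : ℝ}
    (hC : ∀ᵐ v ∂p, |v.2| ≤ C) (s : Side) (q : Bool → ℝ) {t : ℝ} (ht : t ∈ identifiedSet Λ p) :
    s.sgn * t ≤ s.sgn * putativeBound Λ p s q := by
  obtain ⟨k, Q, hQ, hcomp, -, rfl⟩ := ht
  have hΛ0 : 0 < Λ := by linarith
  set A : Full k → Bool := fun v => v.1 with hAdef
  have hA : Measurable A := measurable_fst
  have hY1 : Measurable (fun v : Full k => v.2.1) := by fun_prop
  have hY0 : Measurable (fun v : Full k => v.2.2.1) := by fun_prop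
  have hmass : ∀ a, Q.real (A ⁻¹' {a}) = armProb p a := by
    intro a
    unfold armProb
    rw [← hcomp.observed, measureReal_def, measureReal_def,
      Measure.map_apply (measurable_coarsen k) (measurableSet_arm a)]
    rfl
  have hbd : ∀ a : Bool, ∀ᵐ v ∂(Q.restrict (A ⁻¹' {a})),
      |(if a then v.2.1 else v.2.2.1)| ≤ C := by
    intro a
    rw [← hcomp.observed, ae_map_iff (measurable_coarsen k).aemeasurable
      (measurableSet_le (by fun_prop) (by fun_prop))] at hC
    rw [ae_restrict_iff' (hA (measurableSet_singleton a))]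
    filter_upwards [hC] with v hv hva
    have hva' : v.1 = a := hva
    simpa [coarsen, hva'] using hv
  have hπ0 : (Q⟦A ⁻¹' {false} | confounderSigma k⟧) =ᵐ[Q] fun v => 1 - fullPropensity Q v := by
    have : (A ⁻¹' {false}).indicator (fun _ => (1 : ℝ)) =
        (fun _ => (1 : ℝ)) - (A ⁻¹' {true}).indicator (fun _ => (1 : ℝ)) := by
      ext v
      by_cases hv : A v = true
      · simp [Set.indicator, hv]
      · simp [Set.indicator, hv]
    rw [this]
    refine (condExp_sub (integrable_const 1)
      ((integrable_const 1).indicator (hA (measurableSet_singleton _))) _).trans ?_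
    rw [condExp_const (confounderSigma_le k)]
    rfl
  have hodds : 0 < treatProb p / (1 - treatProb p) := div_pos h0 (by linarith)
  have B1 := sgn_mul_integral_le (confounderSigma_le k) Q hA hY1
    (hcomp.unconfounded.comp measurable_id measurable_fst) true hΛ s (hmass true)
    (armProb_pos h0 h1 true) (armProb_lt_one h0 h1 true) (by
      filter_upwards [hcomp.odds] with v hv
      obtain ⟨a1, a2, a3, a4⟩ := hv
      refine ⟨a1, a2, ?_⟩
      change Λ⁻¹ ≤ (1 - fullPropensity Q v) / fullPropensity Q v *
        (treatProb p / (1 - treatProb p)) ∧ (1 - fullPropensity Q v) / fullPropensity Q v *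
        (treatProb p / (1 - treatProb p)) ≤ Λ
      have : (1 - fullPropensity Q v) / fullPropensity Q v * (treatProb p / (1 - treatProb p)) =
        (fullPropensity Q v / (1 - fullPropensity Q v) / (treatProb p / (1 - treatProb p)))⁻¹ := by
        simp [div_eq_mul_inv, mul_comm]
      rw [this]
      have pos : 0 < fullPropensity Q v / (1 - fullPropensity Q v) /
        (treatProb p / (1 - treatProb p)) := div_pos (div_pos a1 (by linarith)) hodds
      exact ⟨inv_anti₀ pos a4, inv_le_of_inv_le₀ hΛ0 a3⟩) (hbd true) (q true)
  have B0 := sgn_mul_integral_le (confounderSigma_le k) Q hA hY0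
    (hcomp.unconfounded.comp measurable_id measurable_snd) false hΛ s.opp (hmass false)
    (armProb_pos h0 h1 false) (armProb_lt_one h0 h1 false) (by
      filter_upwards [hcomp.odds, hπ0] with v hv hv0
      obtain ⟨a1, a2, a3, a4⟩ := hv
      rw [hv0, armProb_false]
      have : (1 - (1 - fullPropensity Q v)) / (1 - fullPropensity Q v) *
          ((1 - treatProb p) / (1 - (1 - treatProb p))) =
          fullPropensity Q v / (1 - fullPropensity Q v) / (treatProb p / (1 - treatProb p)) := by
        simp [div_eq_mul_inv, mul_comm]
      rw [this]
      exact ⟨by linarith, by linarith, a3, a4⟩) (hbd false) (q false)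
  rw [integral_sub B1.1 B0.1]
  have e1 : ∀ s' : Side, armBound Λ p s' true (q true) = ∫ v in A ⁻¹' {true}, v.2.1 ∂Q +
      (1 - armProb p true) / armProb p true *
        ∫ v in A ⁻¹' {true}, modifiedOutcome Λ s' v.2.1 (q true) ∂Q := by
    intro s'
    unfold armBound armModified
    rw [setIntegral_of_compatible hcomp true (g := fun y => y) measurable_id,
      setIntegral_of_compatible hcomp true (g := fun y => modifiedOutcome Λ s' y (q true))
      ((measurable_modifiedOutcome Λ s').comp (measurable_id.prodMk measurable_const))]
    rfl
  have e0 : ∀ s' : Side, armBound Λ p s' false (q false) = ∫ v in A ⁻¹' {false}, v.2.2.1 ∂Q +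
      (1 - armProb p false) / armProb p false *
        ∫ v in A ⁻¹' {false}, modifiedOutcome Λ s' v.2.2.1 (q false) ∂Q := by
    intro s'
    unfold armBound armModified
    rw [setIntegral_of_compatible hcomp false (g := fun y => y) measurable_id,
      setIntegral_of_compatible hcomp false (g := fun y => modifiedOutcome Λ s' y (q false))
      ((measurable_modifiedOutcome Λ s').comp (measurable_id.prodMk measurable_const))]
    rfl
  have B1' := B1.2
  have B0' := B0.2
  rw [← e1] at B1'
  rw [← e0, Side.sgn_opp] at B0'
  change _ ≤ s.sgn * (armBound Λ p s true (q true) - armBound Λ p s.opp false (q false))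
  linarith

/-- Without a member, `sSup` and `sInf` would take their default value and the outer bounds would
say nothing about them. The member has a one-point confounder (`k = 0`) and independent `A`, `Y(1)`,
`Y(0)`, with `Y(a)` distributed as the outcome in arm `a`; its odds ratio is `1`, allowed since `Λ ≥
1`. -/
theorem identifiedSet_nonempty {Λ : ℝ} (hΛ : 1 ≤ Λ) {p : Measure (Bool × ℝ)}
    [IsProbabilityMeasure p] (h0 : 0 < treatProb p) (h1 : treatProb p < 1) {C : ℝ}
    (hC : ∀ᵐ v ∂p, |v.2| ≤ C) : (identifiedSet Λ p).Nonempty := by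
  have hne : ∀ a, p {v | v.1 = a} ≠ 0 := by
    intro a h
    have := armProb_pos h0 h1 a
    simp [armProb, measureReal_def, h] at this
  have hcp : ∀ a, IsProbabilityMeasure (ProbabilityTheory.cond p {v | v.1 = a}) :=
    fun a => cond_isProbabilityMeasure (hne a)
  set μ : Bool → Measure ℝ := fun a => (ProbabilityTheory.cond p {v | v.1 = a}).map Prod.snd
    with hμ
  have hμp : ∀ a, IsProbabilityMeasure (μ a) := fun a =>
    Measure.isProbabilityMeasure_map measurable_snd.aemeasurable
  have hpA : IsProbabilityMeasure (p.map Prod.fst) :=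
    Measure.isProbabilityMeasure_map measurable_fst.aemeasurable
  set Q : Measure (Full 0) :=
    (p.map Prod.fst).prod ((μ true).prod ((μ false).prod (Measure.dirac 0))) with hQ
  have hAset : ∀ a, MeasurableSet {v : Full 0 | v.1 = a} :=
    fun a => measurable_fst (measurableSet_singleton a)
  have hQA : ∀ a, Q {v | v.1 = a} = p {v | v.1 = a} := by
    intro a
    have : {v : Full 0 | v.1 = a} = {a} ×ˢ Set.univ := by ext; simp
    rw [this, hQ, Measure.prod_prod, measure_univ, mul_one,
      Measure.map_apply measurable_fst (measurableSet_singleton a)]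
    rfl
  have hμint : ∀ a, Integrable (fun y => y) (μ a) := by
    intro a
    refine Integrable.of_bound measurable_id.aestronglyMeasurable C ?_
    rw [hμ, ae_map_iff measurable_snd.aemeasurable (measurableSet_le (by fun_prop) (by fun_prop))]
    exact (cond_absolutelyContinuous (μ := p)).ae_le hC
  have hslice : ∀ (a : Bool) (B : Set (Bool × ℝ)), MeasurableSet B →
      p {v | v.1 = a} * μ a {y | (a, y) ∈ B} = p ({v | v.1 = a} ∩ B) := by
    intro a B hB
    have hBa : MeasurableSet {y : ℝ | (a, y) ∈ B} := measurable_prodMk_left hB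
    rw [hμ, Measure.map_apply measurable_snd hBa, cond_apply (measurableSet_arm a), ← mul_assoc,
      ENNReal.mul_inv_cancel (hne a) (measure_ne_top _ _), one_mul]
    congr 1
    ext ⟨b, y⟩
    simp only [Set.mem_inter_iff, Set.mem_ofPred_eq, Set.mem_preimage]
    exact and_congr_right fun h => by rw [h]
  have hobs : Q.map (coarsen 0) = p := by
    ext B hB
    rw [Measure.map_apply (measurable_coarsen 0) hB,
      ← measure_inter_add_sdiff (coarsen 0 ⁻¹' B) (hAset true),
      ← measure_inter_add_sdiff B (measurableSet_arm true)]
    congr 1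
    · have : coarsen 0 ⁻¹' B ∩ {v : Full 0 | v.1 = true} =
          {true} ×ˢ ({y | (true, y) ∈ B} ×ˢ Set.univ) := by
        ext ⟨b, y1, y0, u⟩
        cases b <;> simp [coarsen]
      rw [this, hQ, Measure.prod_prod, Measure.prod_prod, measure_univ, mul_one,
        Measure.map_apply measurable_fst (measurableSet_singleton true), Set.inter_comm B,
        ← hslice true B hB]
      rfl
    · have : coarsen 0 ⁻¹' B \ {v : Full 0 | v.1 = true} =
          {false} ×ˢ (Set.univ ×ˢ ({y | (false, y) ∈ B} ×ˢ Set.univ)) := by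
        ext ⟨b, y1, y0, u⟩
        cases b <;> simp [coarsen]
      have h' : B \ {v | v.1 = true} = {v | v.1 = false} ∩ B := by
        ext ⟨b, y⟩
        cases b <;> simp
      rw [this, hQ, Measure.prod_prod, Measure.prod_prod, Measure.prod_prod, measure_univ,
        measure_univ, mul_one, one_mul,
        Measure.map_apply measurable_fst (measurableSet_singleton false), h', ← hslice false B hB]
      rfl
  -- `ℝ^0` is a point, so conditioning on `U` is plain integration, and conditional independence
  -- becomes a product formula.
  have hbot : confounderSigma 0 = ⊥ := by
    refine le_antisymm ?_ bot_le
    rintro _ ⟨t, -, rfl⟩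
    rcases t.eq_empty_or_nonempty with ht | ⟨u, hu⟩
    · rw [ht]; exact @MeasurableSet.empty _ ⊥
    · have : t = Set.univ := Set.eq_univ_of_forall fun v => Subsingleton.elim u v ▸ hu
      rw [this]; exact @MeasurableSet.univ _ ⊥
  have hfull : fullPropensity Q = fun _ => treatProb p := by
    unfold fullPropensity
    rw [hbot, condExp_bot]
    funext
    rw [integral_indicator (hAset true)]
    simp [treatProb, measureReal_def, hQA]
  refine ⟨_, 0, Q, inferInstance, ⟨hobs, ?_, ?_⟩, ?_, rfl⟩
  · rw [condIndepFun_iff_condExp_inter_preimage_eq_mul (by fun_prop) (by fun_prop)]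
    intro S T hS hT
    rw [hbot]
    simp only [condExp_bot]
    refine Eventually.of_forall fun _ => ?_
    have hT' : MeasurableSet ((fun v : Full 0 => (v.2.1, v.2.2.1)) ⁻¹' T) :=
      (by fun_prop : Measurable fun v : Full 0 => (v.2.1, v.2.2.1)) hT
    have hS' : MeasurableSet ((fun v : Full 0 => v.1) ⁻¹' S) := measurable_fst hS
    rw [integral_indicator (hS'.inter hT'), integral_indicator hS', integral_indicator hT']
    simp only [integral_const, smul_eq_mul, mul_one, measureReal_def, Measure.restrict_apply_univ]
    rw [← ENNReal.toReal_mul]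
    congr 1
    have r1 : (fun v : Full 0 => v.1) ⁻¹' S = S ×ˢ Set.univ := by ext; simp
    have r2 : (fun v : Full 0 => (v.2.1, v.2.2.1)) ⁻¹' T =
        Set.univ ×ˢ ((fun v : ℝ × ℝ × Cov 0 => (v.1, v.2.1)) ⁻¹' T) := by ext; simp
    have r3 : S ×ˢ Set.univ ∩ Set.univ ×ˢ ((fun v : ℝ × ℝ × Cov 0 => (v.1, v.2.1)) ⁻¹' T) =
        S ×ˢ ((fun v : ℝ × ℝ × Cov 0 => (v.1, v.2.1)) ⁻¹' T) := by
      rw [Set.prod_inter_prod, Set.inter_univ, Set.univ_inter]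
    rw [r1, r2, r3, hQ, Measure.prod_prod, Measure.prod_prod, Measure.prod_prod, measure_univ,
      measure_univ, mul_one, one_mul]
  · rw [hfull]
    refine Eventually.of_forall fun _ => ⟨h0, h1, ?_⟩
    have : treatProb p / (1 - treatProb p) ≠ 0 := (div_pos h0 (by linarith)).ne'
    rw [div_self this]
    exact ⟨inv_le_one_of_one_le₀ hΛ, hΛ⟩
  · refine Integrable.sub ?_ ?_
    · exact ((hμint true).comp_fst _).comp_snd _
    · exact (((hμint false).comp_fst _).comp_snd _).comp_snd _

theorem sgn_mul_cateBound_le {d : ℕ} {Λ : ℝ} (hΛ : 1 ≤ Λ) (P : Measure (Obs d))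
    [IsProbabilityMeasure P] (x : Cov d) (h0 : 0 < propensity P x) (h1 : propensity P x < 1)
    {C : ℝ} (hC : ∀ᵐ v ∂(condLaw P x), |v.2| ≤ C) (s : Side) (q : Bool → ℝ) :
    s.sgn * cateBound Λ P s x ≤ s.sgn * putativeBound Λ (condLaw P x) s q := by
  have : IsProbabilityMeasure (condLaw P x) := by unfold condLaw; infer_instance
  have hne := identifiedSet_nonempty hΛ h0 h1 hC
  have hle := fun t ht => sgn_mul_le_of_mem_identifiedSet hΛ h0 h1 hC s q (t := t) ht
  cases s
  · simp only [Side.sgn, one_mul, cateBound] at hle ⊢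
    exact csSup_le hne hle
  · simp only [Side.sgn, cateBound] at hle ⊢
    have := le_csInf hne fun t ht => (by linarith [hle t ht] :
      putativeBound Λ (condLaw P x) .lower q ≤ t)
    linarith

/-! ### One-arm pseudo-outcomes and double robustness. -/

/-- The pseudo-outcome for `Y(a)` as a function of the values of the nuisances; `e` is the
putative probability of arm `a`. -/
noncomputable def pseudoArm (Λ : ℝ) (s : Side) (a : Bool) (v : Bool × ℝ) (e q r : ℝ) : ℝ :=
  (if v.1 = a then v.2 else r) + (1 - e) / e * (if v.1 = a then modifiedOutcome Λ s v.2 q - r else 0)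

/-- The probability of arm `a` when the propensity score is `e`. -/
def armScore (a : Bool) (e : ℝ) : ℝ := if a then e else 1 - e

theorem pseudoCate_eq {d : ℕ} (Λ : ℝ) (s : Side) (z : Obs d) (η : Nuisance d) :
    pseudoCate Λ s z η =
      pseudoArm Λ (s.arm true) true z.2 (armScore true (η.e z.1)) (η.q (s.arm true) z.1 true)
        (η.ρ (s.arm true) z.1 true) -
      pseudoArm Λ (s.arm false) false z.2 (armScore false (η.e z.1)) (η.q (s.arm false) z.1 false)
        (η.ρ (s.arm false) z.1 false) := by
  obtain ⟨x, a, y⟩ := z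
  cases a <;> simp [pseudoCate, pseudoTreated, pseudoControl, pseudoArm, ind, armScore, Side.arm]

/-- The mean of the pseudo-outcome for `Y(a)` under the law `p` of `(A, Y)`. -/
noncomputable def meanArm (Λ : ℝ) (p : Measure (Bool × ℝ)) (s : Side) (a : Bool) (e q r : ℝ) : ℝ :=
  ∫ v in {v | v.1 = a}, v.2 ∂p + (1 - armProb p a) * r +
    (1 - e) / e * (armModified Λ p s a q - armProb p a * r)

theorem integrable_modifiedOutcome {Λ : ℝ} (hΛ : 1 ≤ Λ) {p : Measure (Bool × ℝ)}
    [IsProbabilityMeasure p] {C : ℝ} (hC : ∀ᵐ v ∂p, |v.2| ≤ C) (s : Side) (q : ℝ) :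
    Integrable (fun v => modifiedOutcome Λ s v.2 q) p := by
  refine Integrable.of_bound ((measurable_modifiedOutcome Λ s).comp
    (measurable_snd.prodMk measurable_const)).aestronglyMeasurable ((2 * Λ + 5) * max C |q|) ?_
  filter_upwards [hC] with v hv
  exact abs_modifiedOutcome_le hΛ s (hv.trans (le_max_left _ _)) (le_max_right _ _)

theorem integrable_snd_of_bound {p : Measure (Bool × ℝ)}
    [IsProbabilityMeasure p] {C : ℝ} (hC : ∀ᵐ v ∂p, |v.2| ≤ C) :
    Integrable (fun v => v.2) p :=
  Integrable.of_bound measurable_snd.aestronglyMeasurable C (by simpa using hC)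

theorem integral_pseudoArm {Λ : ℝ} (hΛ : 1 ≤ Λ) {p : Measure (Bool × ℝ)}
    [IsProbabilityMeasure p] {C : ℝ} (hC : ∀ᵐ v ∂p, |v.2| ≤ C) (s : Side) (a : Bool) (e q r : ℝ) :
    Integrable (fun v => pseudoArm Λ s a v e q r) p ∧
      ∫ v, pseudoArm Λ s a v e q r ∂p = meanArm Λ p s a e q r := by
  have hm := measurableSet_arm a
  have hR := integrable_modifiedOutcome hΛ hC s q
  have hY := integrable_snd_of_bound hC
  have e1 : (fun v : Bool × ℝ => pseudoArm Λ s a v e q r) = fun v =>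
      ({v : Bool × ℝ | v.1 = a}.indicator (fun v => v.2) v +
        {v : Bool × ℝ | v.1 = a}ᶜ.indicator (fun _ => r) v) +
      (1 - e) / e * {v : Bool × ℝ | v.1 = a}.indicator
        (fun v => modifiedOutcome Λ s v.2 q - r) v := by
    ext v
    by_cases h : v.1 = a <;> simp [pseudoArm, Set.indicator, h]
  have i1 : Integrable ({v : Bool × ℝ | v.1 = a}.indicator fun v => v.2) p := hY.indicator hm
  have i2 : Integrable ({v : Bool × ℝ | v.1 = a}ᶜ.indicator fun _ => r) p :=
    (integrable_const r).indicator hm.compl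
  have i3 : Integrable ({v : Bool × ℝ | v.1 = a}.indicator
      fun v => modifiedOutcome Λ s v.2 q - r) p := (hR.sub (integrable_const r)).indicator hm
  rw [e1]
  have i12 : Integrable (fun v => {v : Bool × ℝ | v.1 = a}.indicator (fun v => v.2) v +
    {v : Bool × ℝ | v.1 = a}ᶜ.indicator (fun _ => r) v) p := i1.add i2
  refine ⟨i12.add (i3.const_mul _), ?_⟩
  have hi : IntegrableOn (fun _ : Bool × ℝ => r) {v | v.1 = a} p :=
    (integrable_const r).integrableOn
  rw [integral_add i12 (i3.const_mul _), integral_add i1 i2, integral_const_mul,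
    integral_indicator hm, integral_indicator hm.compl, integral_indicator hm,
    integral_sub hR.integrableOn hi, setIntegral_const, setIntegral_const, probReal_compl_eq_one_sub hm]
  rfl

theorem abs_armModified_le {Λ : ℝ} (hΛ : 1 ≤ Λ) {p : Measure (Bool × ℝ)}
    [IsProbabilityMeasure p] {C : ℝ} (hC : ∀ᵐ v ∂p, |v.2| ≤ C) (s : Side) (a : Bool) {q : ℝ}
    (hq : |q| ≤ C) : |armModified Λ p s a q| ≤ (2 * Λ + 5) * C * armProb p a := by
  refine norm_setIntegral_le_of_norm_le_const_ae (μ := p) (s := {v | v.1 = a})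
    (f := fun v => modifiedOutcome Λ s v.2 q) (measure_lt_top _ _) ?_
  filter_upwards [ae_restrict_of_ae hC] with v hv
  exact abs_modifiedOutcome_le hΛ s hv hq

theorem abs_armModified_sub_le {Λ : ℝ} (hΛ : 1 ≤ Λ) {p : Measure (Bool × ℝ)}
    [IsProbabilityMeasure p] {C : ℝ} (hC : ∀ᵐ v ∂p, |v.2| ≤ C) (s : Side) (a : Bool) (q q' : ℝ) :
    |armModified Λ p s a q - armModified Λ p s a q'| ≤ (Λ + 2) * |q - q'| * armProb p a := by
  unfold armModified
  rw [← integral_sub (integrable_modifiedOutcome hΛ hC s q).integrableOn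
    (integrable_modifiedOutcome hΛ hC s q').integrableOn]
  exact norm_setIntegral_le_of_norm_le_const (μ := p) (s := {v | v.1 = a})
    (f := fun v => modifiedOutcome Λ s v.2 q - modifiedOutcome Λ s v.2 q') (measure_lt_top _ _)
    fun v _ => lipschitz_modifiedOutcome hΛ s v.2 q q'

/-- The integral of `R` over the arm carries a factor `armProb p a` that cancels the denominator, so
no overlap constant enters. -/
theorem abs_armBound_le {Λ : ℝ} (hΛ : 1 ≤ Λ) {p : Measure (Bool × ℝ)} [IsProbabilityMeasure p]
    {C : ℝ} (hC : ∀ᵐ v ∂p, |v.2| ≤ C) (s : Side) (a : Bool) (h0 : 0 < armProb p a) {q : ℝ}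
    (hq : |q| ≤ C) : |armBound Λ p s a q| ≤ C + (2 * Λ + 5) * C := by
  have hC0 : 0 ≤ C := (abs_nonneg q).trans hq
  have h1 : armProb p a ≤ 1 := measureReal_le_one
  unfold armBound
  refine (abs_add_le _ _).trans (add_le_add ?_ ?_)
  · have : |∫ v in {v | v.1 = a}, v.2 ∂p| ≤ C * armProb p a :=
      norm_setIntegral_le_of_norm_le_const_ae (μ := p) (s := {v | v.1 = a})
        (f := fun v => v.2) (measure_lt_top _ _) (ae_restrict_of_ae hC)
    nlinarith
  · rw [abs_mul, abs_of_nonneg (div_nonneg (by linarith) h0.le)]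
    have h2 := abs_armModified_le hΛ hC s a hq
    have h3 : 0 ≤ (1 - armProb p a) / armProb p a := div_nonneg (by linarith) h0.le
    calc (1 - armProb p a) / armProb p a * |armModified Λ p s a q|
        ≤ (1 - armProb p a) / armProb p a * ((2 * Λ + 5) * C * armProb p a) := by gcongr
      _ = (1 - armProb p a) * ((2 * Λ + 5) * C) := by field_simp
      _ ≤ 1 * ((2 * Λ + 5) * C) := by gcongr; linarith
      _ = _ := one_mul _

theorem abs_pseudoArm_le {Λ : ℝ} (hΛ : 1 ≤ Λ) (s : Side) (a : Bool) {v : Bool × ℝ}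
    {ε C e q r : ℝ} (hε : 0 < ε) (he : ε ≤ e) (he1 : e ≤ 1) (hy : |v.2| ≤ C) (hq : |q| ≤ C)
    (hr : |r| ≤ C) : |pseudoArm Λ s a v e q r| ≤ C + 1 / ε * ((2 * Λ + 5) * C + C) := by
  have hC0 : 0 ≤ C := (abs_nonneg q).trans hq
  have he0 : 0 < e := by linarith
  unfold pseudoArm
  refine (abs_add_le _ _).trans (add_le_add ?_ ?_)
  · split_ifs <;> assumption
  · rw [abs_mul, abs_of_nonneg (div_nonneg (by linarith) he0.le)]
    refine mul_le_mul ?_ ?_ (abs_nonneg _) (by positivity)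
    · exact div_le_div₀ (by norm_num) (by linarith) hε he
    · split_ifs
      · exact (abs_sub _ _).trans (add_le_add (abs_modifiedOutcome_le hΛ s hy hq) hr)
      · simp only [abs_zero]; positivity

/-- Double robustness. Let `π` be the true arm probability and `N`, `N'` the regressions of `R` at
`q` and `qbar`. The difference equals `(1 - π)(N - N') + (N - r)(π - e) / e`. The first term is
Lipschitz in `q - qbar`. In the second, either `π - e` is small while `N - r` is bounded by `(2Λ +
6) C`, or `N - r` is at most `(Λ + 3) δ`, being close to `N' - r`, while `|π - e| ≤ 1`. The final
constant covers both cases. -/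
theorem abs_meanArm_sub_armBound_le {Λ : ℝ} (hΛ : 1 ≤ Λ) {p : Measure (Bool × ℝ)}
    [IsProbabilityMeasure p] {C : ℝ} (hC : ∀ᵐ v ∂p, |v.2| ≤ C) (s : Side) (a : Bool)
    (h0 : 0 < armProb p a) {ε δ e q r qbar : ℝ} (hε : 0 < ε) (he : ε ≤ e) (he1 : e ≤ 1)
    (hq : |q| ≤ C) (hr : |r| ≤ C) (hqq : |q - qbar| ≤ δ)
    (hor : |e - armProb p a| ≤ δ ∨ |r - armModified Λ p s a qbar / armProb p a| ≤ δ) :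
    |meanArm Λ p s a e q r - armBound Λ p s a qbar| ≤
      ((Λ + 2) + ((2 * Λ + 6) * C + (Λ + 3)) / ε) * δ := by
  have hC0 : 0 ≤ C := (abs_nonneg q).trans hq
  have he0 : 0 < e := by linarith
  have hδ0 : 0 ≤ δ := (abs_nonneg _).trans hqq
  have h1 : armProb p a ≤ 1 := measureReal_le_one
  set π := armProb p a with hπ
  set N := armModified Λ p s a q / π with hN
  set N' := armModified Λ p s a qbar / π with hN'
  have hNq : armModified Λ p s a q = N * π := by rw [hN]; field_simp
  have hNq' : armModified Λ p s a qbar = N' * π := by rw [hN']; field_simp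
  have hNb : |N| ≤ (2 * Λ + 5) * C := by
    rw [hN, abs_div, abs_of_pos h0, div_le_iff₀ h0]
    exact abs_armModified_le hΛ hC s a hq
  have hNN : |N - N'| ≤ (Λ + 2) * δ := by
    rw [hN, hN', ← sub_div, abs_div, abs_of_pos h0, div_le_iff₀ h0]
    refine (abs_armModified_sub_le hΛ hC s a q qbar).trans ?_
    gcongr
  have hid : meanArm Λ p s a e q r - armBound Λ p s a qbar =
      (1 - π) * (N - N') + (N - r) * ((π - e) / e) := by
    unfold meanArm armBound
    rw [← hπ, hNq, hNq']
    field_simp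
    ring
  rw [hid]
  have t1 : |(1 - π) * (N - N')| ≤ (Λ + 2) * δ := by
    rw [abs_mul, abs_of_nonneg (by linarith : 0 ≤ 1 - π)]
    calc (1 - π) * |N - N'| ≤ 1 * ((Λ + 2) * δ) := by gcongr; linarith
      _ = _ := one_mul _
  have t2 : |(N - r) * ((π - e) / e)| ≤ ((2 * Λ + 6) * C + (Λ + 3)) / ε * δ := by
    rw [abs_mul, abs_div, abs_of_pos he0]
    have hNr : |N - r| ≤ (2 * Λ + 6) * C :=
      ((abs_sub _ _).trans (add_le_add hNb hr)).trans (by linarith)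
    rcases hor with h | h
    · rw [abs_sub_comm] at h
      calc |N - r| * (|π - e| / e) ≤ ((2 * Λ + 6) * C) * (δ / ε) := by gcongr
        _ = (2 * Λ + 6) * C / ε * δ := by ring
        _ ≤ _ := by gcongr; linarith
    · have h2 : |N - r| ≤ (Λ + 3) * δ := by
        calc |N - r| = |(N - N') - (r - N')| := by ring_nf
          _ ≤ (Λ + 2) * δ + δ := (abs_sub _ _).trans (add_le_add hNN h)
          _ = _ := by ring
      have h3 : |π - e| ≤ 1 := by rw [abs_le]; constructor <;> linarith
      calc |N - r| * (|π - e| / e) ≤ ((Λ + 3) * δ) * (1 / ε) := by gcongr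
        _ = (Λ + 3) / ε * δ := by ring
        _ ≤ _ := mul_le_mul_of_nonneg_right (div_le_div_of_nonneg_right
            (by linarith [mul_nonneg (by linarith : 0 ≤ 2 * Λ + 6) hC0]) hε.le) hδ0
  calc _ ≤ _ := (abs_add_le _ _).trans (add_le_add t1 t2)
    _ = _ := by ring

theorem modifiedRegression_eq {d : ℕ} (Λ : ℝ) (P : Measure (Obs d)) [IsProbabilityMeasure P]
    (s : Side) (x : Cov d) (a : Bool) (q : ℝ) :
    modifiedRegression Λ P s x a q =
      armModified Λ (condLaw P x) s a q / armProb (condLaw P x) a := by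
  unfold modifiedRegression outcomeLaw armModified armProb
  rw [integral_map (f := fun y => modifiedOutcome Λ s y q) measurable_snd.aemeasurable
    ((measurable_modifiedOutcome Λ s).comp
      (measurable_id.prodMk measurable_const)).aestronglyMeasurable,
    ProbabilityTheory.cond, integral_smul_measure, ENNReal.toReal_inv, div_eq_inv_mul]
  rfl

theorem measurable_pseudoArm {Ω : Type*} [MeasurableSpace Ω] (Λ : ℝ) (s : Side) (a : Bool) {v : Ω → Bool × ℝ} {e q r : Ω → ℝ}
    (hv : Measurable v) (he : Measurable e) (hq : Measurable q) (hr : Measurable r) :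
    Measurable fun ω => pseudoArm Λ s a (v ω) (e ω) (q ω) (r ω) := by
  have hA : MeasurableSet {ω | (v ω).1 = a} := hv (measurableSet_arm a)
  have hR : Measurable fun ω => modifiedOutcome Λ s (v ω).2 (q ω) :=
    (measurable_modifiedOutcome Λ s).comp ((measurable_snd.comp hv).prodMk hq)
  unfold pseudoArm
  exact (Measurable.ite hA (by fun_prop) hr).add
    (((measurable_const.sub he).div he).mul (Measurable.ite hA (hR.sub hr) measurable_const))

/-! ### Measurability of conditional integrals. -/

section measurability

variable {d : ℕ} (P : Measure (Obs d)) [IsProbabilityMeasure P] {Ω : Type*} [MeasurableSpace Ω]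
  {X : Ω → Cov d}

/-- `condLaw` is a Markov kernel in the covariate, so integration against it preserves joint
measurability in a parameter. -/
theorem measurable_setIntegral_condLaw (hX : Measurable X) (a : Bool) {g : Ω → ℝ → ℝ}
    (hg : Measurable (Function.uncurry g)) :
    Measurable fun ω => ∫ v in {v | v.1 = a}, g ω v.2 ∂(condLaw P (X ω)) := by
  have hf : StronglyMeasurable fun p : Ω × (Bool × ℝ) => g p.1 p.2.2 :=
    (hg.comp (measurable_fst.prodMk (measurable_snd.comp measurable_snd))).stronglyMeasurable
  have := hf.integral_kernel_prod_right' (κ := (P.condKernel.restrict (measurableSet_arm a)).comap X hX)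
  simpa [Kernel.comap_apply, Kernel.restrict_apply, condLaw] using this.measurable

theorem measurable_armProb (hX : Measurable X) (a : Bool) :
    Measurable fun ω => armProb (condLaw P (X ω)) a :=
  ((Kernel.measurable_coe P.condKernel (measurableSet_arm a)).comp hX).ennreal_toReal

theorem measurable_armModified (Λ : ℝ) (s : Side) (hX : Measurable X) (a : Bool) {q : Ω → ℝ}
    (hq : Measurable q) : Measurable fun ω => armModified Λ (condLaw P (X ω)) s a (q ω) :=
  measurable_setIntegral_condLaw P hX a (g := fun ω y => modifiedOutcome Λ s y (q ω))
    ((measurable_modifiedOutcome Λ s).comp (measurable_snd.prodMk (hq.comp measurable_fst)))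

theorem measurable_armBound (Λ : ℝ) (s : Side) (hX : Measurable X) (a : Bool) {q : Ω → ℝ}
    (hq : Measurable q) : Measurable fun ω => armBound Λ (condLaw P (X ω)) s a (q ω) := by
  have h1 := measurable_setIntegral_condLaw P hX a (g := fun _ y => y) measurable_snd
  have h2 := measurable_armProb P hX a
  have h3 := measurable_armModified P Λ s hX a hq
  unfold armBound
  fun_prop

theorem measurable_meanArm (Λ : ℝ) (s : Side) (hX : Measurable X) (a : Bool) {e q r : Ω → ℝ}
    (he : Measurable e) (hq : Measurable q) (hr : Measurable r) :
    Measurable fun ω => meanArm Λ (condLaw P (X ω)) s a (e ω) (q ω) (r ω) := by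
  have h1 := measurable_setIntegral_condLaw P hX a (g := fun _ y => y) measurable_snd
  have h2 := measurable_armProb P hX a
  have h3 := measurable_armModified P Λ s hX a hq
  unfold meanArm
  fun_prop

end measurability

/-! ### Replacing one observation by an independent copy. -/

/-- On a box, the discarded coordinate contributes total mass `1` and the fresh draw supplies the
factor of coordinate `i`. -/
theorem measurePreserving_update {ι Z : Type*} [Fintype ι] [DecidableEq ι] [MeasurableSpace Z]
    (μ : Measure Z) [IsProbabilityMeasure μ] (i : ι) :
    MeasurePreserving (fun p : (ι → Z) × Z => Function.update p.1 i p.2)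
      ((Measure.pi fun _ : ι => μ).prod μ) (Measure.pi fun _ : ι => μ) := by
  have hm : Measurable (fun p : (ι → Z) × Z => Function.update p.1 i p.2) := by
    rw [measurable_pi_iff]
    intro j
    by_cases h : j = i
    · subst h; simpa using measurable_snd
    · simp only [Function.update_of_ne h]; fun_prop
  refine ⟨hm, (Measure.pi_eq fun s hs => ?_).symm⟩
  rw [Measure.map_apply hm (MeasurableSet.univ_pi hs)]
  have : (fun p : (ι → Z) × Z => Function.update p.1 i p.2) ⁻¹' (Set.univ.pi s) =
      (Set.univ.pi (Function.update s i Set.univ)) ×ˢ s i := by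
    ext p
    simp only [Set.mem_preimage, Set.mem_univ_pi, Set.mem_prod]
    constructor
    · refine fun h => ⟨fun j => ?_, by simpa using h i⟩
      by_cases hj : j = i
      · subst hj; simp
      · simpa [Function.update_of_ne hj] using h j
    · rintro ⟨h1, h2⟩ j
      by_cases hj : j = i
      · subst hj; simpa using h2
      · simpa [Function.update_of_ne hj] using h1 j
  rw [this, Measure.prod_prod, Measure.pi_pi, ← Finset.prod_erase_mul _ _ (Finset.mem_univ i),
    ← Finset.prod_erase_mul _ (fun j => μ (s j)) (Finset.mem_univ i)]
  simp only [Function.update_self, measure_univ, mul_one]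
  congr 1
  refine Finset.prod_congr rfl fun j hj => ?_
  rw [Function.update_of_ne (Finset.ne_of_mem_erase hj)]

/-- Replace observation `i` by a fresh one. -/
def resample {S : Type*} {d n : ℕ} (i : Fin n) (p : ((S × (Fin n → Obs d)) × Cov d) × Obs d) :
    (S × (Fin n → Obs d)) × Cov d :=
  ((p.1.1.1, Function.update p.1.1.2 i p.2), p.1.2)

/-- The data from which the nuisances of fold `k` are estimated. -/
def foldData {S : Type*} {d : ℕ} (K k : ℕ) {n : ℕ} (p : S × (Fin n → Obs d)) : S × Training d n K k :=
  (p.1, training K k p.2)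

theorem foldData_resample {S : Type*} {d : ℕ} {K k n : ℕ} {i : Fin n} (hi : (i : ℕ) % K = k)
    (p : ((S × (Fin n → Obs d)) × Cov d) × Obs d) :
    foldData K k (resample i p).1 = foldData K k p.1.1 := by
  unfold foldData resample training
  congr 1
  funext j
  have : j.1 ≠ i := fun h => j.2 (h ▸ hi)
  simp [Function.update_of_ne this]

theorem ae_of_ae_fst {d : ℕ} (P : Measure (Obs d)) {p : Cov d → Prop} (h : ∀ᵐ x ∂P.fst, p x) : ∀ᵐ z ∂P, p z.1 :=
  ae_of_ae_map measurable_fst.aemeasurable h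

section sampling

variable {S : Type*} [MeasurableSpace S] {d : ℕ} (γ : ℕ → Measure S)
  [∀ n, IsProbabilityMeasure (γ n)] (P : Measure (Obs d)) [IsProbabilityMeasure P]
  (ν : Measure (Cov d)) [IsProbabilityMeasure ν]

instance isProbabilityMeasure_sampleLaw (n : ℕ) : IsProbabilityMeasure (sampleLaw γ P n) := by
  unfold sampleLaw; infer_instance

instance isProbabilityMeasure_evalLaw (n : ℕ) : IsProbabilityMeasure (evalLaw γ P ν n) := by
  unfold evalLaw; infer_instance

instance isProbabilityMeasure_condLaw (x : Cov d) : IsProbabilityMeasure (condLaw P x) := by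
  unfold condLaw; infer_instance

theorem measurePreserving_resample {n : ℕ} (i : Fin n) :
    MeasurePreserving (resample (S := S) i) ((evalLaw γ P ν n).prod P) (evalLaw γ P ν n) := by
  unfold evalLaw sampleLaw
  have h1 := measurePreserving_prodAssoc ((γ n).prod (Measure.pi fun _ : Fin n => P)) ν P
  have h2 := (MeasurePreserving.id ((γ n).prod (Measure.pi fun _ : Fin n => P))).prod
    (Measure.measurePreserving_swap (μ := ν) (ν := P))
  have h3 := (measurePreserving_prodAssoc ((γ n).prod (Measure.pi fun _ : Fin n => P)) P ν).symm
  have h4 := measurePreserving_prodAssoc (γ n) (Measure.pi fun _ : Fin n => P) P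
  have h5 := (MeasurePreserving.id (γ n)).prod (measurePreserving_update P i)
  have h6 := (h5.comp h4).prod (MeasurePreserving.id ν)
  exact h6.comp (h3.comp (h2.comp h1))

theorem measurable_foldData (K k : ℕ) {n : ℕ} :
    Measurable (foldData (S := S) (d := d) (n := n) K k) := by
  unfold foldData training
  fun_prop

/-- Resampling observation `i` leaves the training data of its own fold unchanged, so the pair
behaves as training data with an independent draw from `P`, and Fubini applies. -/
theorem ae_foldData_obs {K k n : ℕ} {i : Fin n} (hi : (i : ℕ) % K = k)
    {Φ : Set ((S × Training d n K k) × Obs d)} (hΦ : MeasurableSet Φ)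
    (h : ∀ᵐ D ∂(sampleLaw γ P n), ∀ᵐ z ∂P, (foldData K k D, z) ∈ Φ) :
    ∀ᵐ p ∂(evalLaw γ P ν n), (foldData K k p.1, p.1.2 i) ∈ Φ := by
  have hm : Measurable fun p : (S × (Fin n → Obs d)) × Cov d => (foldData K k p.1, p.1.2 i) :=
    ((measurable_foldData K k).comp measurable_fst).prodMk (by fun_prop)
  have hset : MeasurableSet {p : (S × (Fin n → Obs d)) × Cov d |
    (foldData K k p.1, p.1.2 i) ∈ Φ} := hm hΦ
  rw [← (measurePreserving_resample γ P ν i).map_eq,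
    ae_map_iff (measurePreserving_resample γ P ν i).measurable.aemeasurable hset]
  have hset' : MeasurableSet {q : ((S × (Fin n → Obs d)) × Cov d) × Obs d |
      (foldData K k (resample i q).1, (resample i q).1.2 i) ∈ Φ} :=
    (measurePreserving_resample γ P ν i).measurable hset
  rw [Measure.ae_prod_iff_ae_ae hset']
  have h' : ∀ᵐ p ∂(evalLaw γ P ν n), ∀ᵐ z ∂P, (foldData K k p.1, z) ∈ Φ :=
    Measure.quasiMeasurePreserving_fst.ae h
  filter_upwards [h'] with p hp
  filter_upwards [hp] with z hz
  rw [foldData_resample hi]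
  simpa [resample] using hz

/-- A property which holds for almost every covariate value, given the training data of a fold,
holds at the observations of that fold. -/
theorem ae_foldData_of_ae {K k n : ℕ} {G : Set ((S × Training d n K k) × Cov d)}
    (hG : MeasurableSet G) :
    ∀ᵐ p ∂(evalLaw γ P ν n), (∀ᵐ x ∂P.fst, (foldData K k p.1, x) ∈ G) →
      ∀ i : Fin n, (i : ℕ) % K = k → (foldData K k p.1, (p.1.2 i).1) ∈ G := by
  have hT : MeasurableSet {t : S × Training d n K k | ∀ᵐ x ∂P.fst, (t, x) ∈ G} := by
    have : {t : S × Training d n K k | ∀ᵐ x ∂P.fst, (t, x) ∈ G} =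
        (fun t => P.fst (Prod.mk t ⁻¹' Gᶜ)) ⁻¹' {0} := by
      ext t; simp [ae_iff, Set.preimage, Set.compl_def]
    rw [this]
    exact measurable_measure_prodMk_left hG.compl (measurableSet_singleton 0)
  -- The premise on the training data is put inside `Φ`, so that membership holds almost surely for
  -- good and bad training samples alike.
  set Φ : Set ((S × Training d n K k) × Obs d) :=
    {t | (∀ᵐ x ∂P.fst, (t.1, x) ∈ G) → (t.1, t.2.1) ∈ G} with hΦdef
  have hΦ : MeasurableSet Φ := by
    have : Φ = (Prod.fst ⁻¹' {t : S × Training d n K k | ∀ᵐ x ∂P.fst, (t, x) ∈ G})ᶜ ∪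
        (fun t : (S × Training d n K k) × Obs d => (t.1, t.2.1)) ⁻¹' G := by
      ext t; simp [hΦdef, imp_iff_not_or]
    rw [this]
    exact (measurable_fst hT).compl.union ((by fun_prop : Measurable
      fun t : (S × Training d n K k) × Obs d => (t.1, t.2.1)) hG)
  have key : ∀ i : Fin n, (i : ℕ) % K = k →
      ∀ᵐ p ∂(evalLaw γ P ν n), (foldData K k p.1, p.1.2 i) ∈ Φ := by
    intro i hi
    refine ae_foldData_obs γ P ν hi hΦ (Eventually.of_forall fun D => ?_)
    by_cases hD : ∀ᵐ x ∂P.fst, (foldData K k D, x) ∈ G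
    · filter_upwards [ae_of_ae_fst P hD] with z hz _ using hz
    · exact Eventually.of_forall fun z h => absurd h hD
  have : ∀ᵐ p ∂(evalLaw γ P ν n), ∀ i : Fin n, (i : ℕ) % K = k →
      (foldData K k p.1, p.1.2 i) ∈ Φ := by
    rw [ae_all_iff]; intro i
    by_cases hi : (i : ℕ) % K = k
    · filter_upwards [key i hi] with p hp _ using hp
    · exact Eventually.of_forall fun p h => absurd h hi
  filter_upwards [this] with p hp h i hi using hp i hi h

/-- A factor with conditional mean zero given everything but the outcome and treatment of
observation `i` integrates to zero. -/
theorem integral_mul_eq_zero_of_condMean_zero {K k n : ℕ} {i : Fin n} (hi : (i : ℕ) % K = k)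
    {ξ : (S × Training d n K k) × Obs d → ℝ}
    (hξ0 : ∀ᵐ D ∂(sampleLaw γ P n), ∀ᵐ x ∂P.fst, ∫ v, ξ (foldData K k D, (x, v)) ∂(condLaw P x) = 0)
    {H : (S × (Fin n → Obs d)) × Cov d → ℝ}
    (hHv : ∀ p x v v', H (resample i (p, (x, v))) = H (resample i (p, (x, v'))))
    (hint : Integrable (fun p => H p * ξ (foldData K k p.1, p.1.2 i)) (evalLaw γ P ν n)) :
    ∫ p, H p * ξ (foldData K k p.1, p.1.2 i) ∂(evalLaw γ P ν n) = 0 := by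
  have hmp := measurePreserving_resample γ P ν (n := n) i
  set F : (S × (Fin n → Obs d)) × Cov d → ℝ := fun p => H p * ξ (foldData K k p.1, p.1.2 i)
    with hF
  have hint' : Integrable (fun q => F (resample i q)) ((evalLaw γ P ν n).prod P) :=
    hmp.integrable_comp_of_integrable hint
  have e1 : ∫ p, F p ∂(evalLaw γ P ν n) = ∫ q, F (resample i q) ∂((evalLaw γ P ν n).prod P) := by
    rw [← integral_map hmp.measurable.aemeasurable
      (by rw [hmp.map_eq]; exact hint.aestronglyMeasurable), hmp.map_eq]
  rw [e1, integral_prod _ hint']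
  have h' : ∀ᵐ p ∂(evalLaw γ P ν n), ∀ᵐ x ∂P.fst,
      ∫ v, ξ (foldData K k p.1, (x, v)) ∂(condLaw P x) = 0 :=
    Measure.quasiMeasurePreserving_fst.ae hξ0
  refine integral_eq_zero_of_ae ?_
  filter_upwards [h', hint'.prod_right_ae] with p hp hpint
  rw [Pi.zero_apply, ← Measure.integral_condKernel hpint]
  refine integral_eq_zero_of_ae ?_
  filter_upwards [hp] with x hx
  -- The value `(true, 0)` is an arbitrary reference: `H` does not see the treatment and outcome of
  -- observation `i`, so it leaves the inner integral and only the centred factor remains.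
  have : ∀ v, F (resample i (p, (x, v))) =
      H (resample i (p, (x, (true, 0)))) * ξ (foldData K k p.1, (x, v)) := by
    intro v
    simp only [hF]
    rw [foldData_resample hi, hHv p x v (true, 0)]
    simp [resample]
  simp only [this, integral_const_mul, Pi.zero_apply]
  rw [← condLaw, hx, mul_zero]

end sampling

theorem ae_obs {S : Type*} [MeasurableSpace S] {d : ℕ} (γ : ℕ → Measure S) (P : Measure (Obs d))
    [IsProbabilityMeasure P] (ν : Measure (Cov d)) [SFinite ν] {n : ℕ} {φ : Obs d → Prop} (h : ∀ᵐ z ∂P, φ z) :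
    ∀ᵐ p ∂(evalLaw γ P ν n), ∀ i : Fin n, φ (p.1.2 i) := by
  rw [ae_all_iff]
  intro i
  have h1 : MeasurePreserving (Function.eval i) (Measure.pi fun _ : Fin n => P) P :=
    measurePreserving_eval (fun _ : Fin n => P) i
  have h2 := h1.quasiMeasurePreserving.ae h
  have h3 : ∀ᵐ D ∂(sampleLaw γ P n), φ (D.2 i) := Measure.quasiMeasurePreserving_snd.ae h2
  exact Measure.quasiMeasurePreserving_fst.ae h3

/-! ### Weighted sums of centred terms. -/

theorem tendsto_measure_zero_of_real {Ω : ℕ → Type*} [∀ n, MeasurableSpace (Ω n)]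
    {μ : ∀ n, Measure (Ω n)} [∀ n, IsFiniteMeasure (μ n)] {E : ∀ n, Set (Ω n)}
    (h : ∀ δ : ℝ, 0 < δ → ∀ᶠ n in atTop, (μ n).real (E n) ≤ δ) :
    Tendsto (fun n => μ n (E n)) atTop (𝓝 0) := by
  rw [← ENNReal.tendsto_toReal_iff (fun n => measure_ne_top _ _) (by simp)]
  rw [ENNReal.toReal_zero, Metric.tendsto_nhds]
  intro ε hε
  filter_upwards [h (ε / 2) (by linarith)] with n hn
  rw [Real.dist_eq, sub_zero, abs_of_nonneg ENNReal.toReal_nonneg]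
  exact lt_of_le_of_lt hn (by linarith)

theorem eventually_real_le {Ω : ℕ → Type*} [∀ n, MeasurableSpace (Ω n)]
    {μ : ∀ n, Measure (Ω n)} {E : ∀ n, Set (Ω n)}
    (h : Tendsto (fun n => μ n (E n)) atTop (𝓝 0)) {δ : ℝ} (hδ : 0 < δ) :
    ∀ᶠ n in atTop, (μ n).real (E n) ≤ δ := by
  filter_upwards [ENNReal.tendsto_nhds_zero.1 h (ENNReal.ofReal δ) (by simpa using hδ)] with n hn
  exact ENNReal.toReal_le_of_le_ofReal hδ.le hn

/-- The observations of fold `k`. -/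
def foldIndices (K k n : ℕ) : Finset (Fin n) := Finset.univ.filter fun i => (i : ℕ) % K = k

theorem mem_foldIndices {K k n : ℕ} {i : Fin n} : i ∈ foldIndices K k n ↔ (i : ℕ) % K = k := by
  simp [foldIndices]

/-- The weights see the observations only through the covariates. Hence they may be treated as
constants when integrating over the treatment and outcome of one observation. -/
theorem normalized_resample {S : Type*} {d : ℕ} (w : Weights S d) {n : ℕ} (i j : Fin n)
    (p : (S × (Fin n → Obs d)) × Cov d) (x : Cov d) (v v' : Bool × ℝ) :
    w.normalized j (resample i (p, (x, v))).1 (resample i (p, (x, v))).2 =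
      w.normalized j (resample i (p, (x, v'))).1 (resample i (p, (x, v'))).2 := by
  have : (fun j => ((resample i (p, (x, v))).1.2 j).1) =
      fun j => ((resample i (p, (x, v'))).1.2 j).1 := by
    funext j
    by_cases h : j = i
    · subst h; simp [resample]
    · simp [resample, Function.update_of_ne h]
  unfold Weights.normalized
  rw [this]
  rfl

section weights

variable {S : Type*} [MeasurableSpace S] {d : ℕ} {γ : ℕ → Measure S}
  [∀ n, IsProbabilityMeasure (γ n)] {P : Measure (Obs d)} [IsProbabilityMeasure P]
  {ν : Measure (Cov d)} [IsProbabilityMeasure ν] {w : Weights S d}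

theorem measurable_normalized (hw : w.IsMeasurable) {n : ℕ} (i : Fin n) :
    Measurable fun p : (S × (Fin n → Obs d)) × Cov d => w.normalized i p.1 p.2 := by
  unfold Weights.normalized
  have h : Measurable fun p : (S × (Fin n → Obs d)) × Cov d =>
    (p.1.1, (fun j => (p.1.2 j).1), p.2) := by fun_prop
  exact Measurable.div_const ((hw n i).comp h) _

/-- The square is expanded. For distinct `i`, `j` in the fold, the weights, the nuisances and the
term at `j` ignore the treatment and outcome of observation `i`, whose own term is centred, so the
cross term integrates to zero. Only the diagonal remains, with each centred factor at most `B`. -/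
theorem integral_sq_le {K k n : ℕ} (hw : w.IsMeasurable) {M : ℝ}
    (hM : ∀ᵐ p ∂(evalLaw γ P ν n), ∑ i : Fin n, |w.normalized i p.1 p.2| ≤ M)
    {ξ : (S × Training d n K k) × Obs d → ℝ} (hξ : Measurable ξ) {B : ℝ}
    (hξB : ∀ᵐ D ∂(sampleLaw γ P n), ∀ᵐ z ∂P, |ξ (foldData K k D, z)| ≤ B)
    (hξ0 : ∀ᵐ D ∂(sampleLaw γ P n), ∀ᵐ x ∂P.fst,
      ∫ v, ξ (foldData K k D, (x, v)) ∂(condLaw P x) = 0) :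
    Integrable (fun p => (∑ i ∈ foldIndices K k n,
      w.normalized i p.1 p.2 * ξ (foldData K k p.1, p.1.2 i)) ^ 2) (evalLaw γ P ν n) ∧
    ∫ p, (∑ i ∈ foldIndices K k n,
      w.normalized i p.1 p.2 * ξ (foldData K k p.1, p.1.2 i)) ^ 2 ∂(evalLaw γ P ν n) ≤
    B ^ 2 * ∫ p, ∑ i : Fin n, w.normalized i p.1 p.2 ^ 2 ∂(evalLaw γ P ν n) := by
  set W : Fin n → (S × (Fin n → Obs d)) × Cov d → ℝ := fun i p => w.normalized i p.1 p.2 with hW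
  set X : Fin n → (S × (Fin n → Obs d)) × Cov d → ℝ :=
    fun i p => ξ (foldData K k p.1, p.1.2 i) with hX
  have hWm : ∀ i, Measurable (W i) := fun i => measurable_normalized hw i
  have hXm : ∀ i, Measurable (X i) := fun i =>
    hξ.comp (((measurable_foldData K k).comp measurable_fst).prodMk (by fun_prop))
  have hWb : ∀ i, ∀ᵐ p ∂(evalLaw γ P ν n), |W i p| ≤ M := by
    intro i
    filter_upwards [hM] with p hp
    exact (Finset.single_le_sum (f := fun i => |W i p|) (fun _ _ => abs_nonneg _)
      (Finset.mem_univ i)).trans hp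
  have hXb : ∀ i : Fin n, (i : ℕ) % K = k → ∀ᵐ p ∂(evalLaw γ P ν n), |X i p| ≤ B := fun i hi =>
    ae_foldData_obs γ P ν hi (Φ := {t | |ξ t| ≤ B})
      (measurableSet_le (by fun_prop) (by fun_prop)) hξB
  have hint : ∀ i j : Fin n, (i : ℕ) % K = k → (j : ℕ) % K = k →
      Integrable (fun p => (W i p * X i p) * (W j p * X j p)) (evalLaw γ P ν n) := by
    intro i j hi hj
    refine Integrable.of_bound (by fun_prop) ((M * B) * (M * B)) ?_
    filter_upwards [hWb i, hWb j, hXb i hi, hXb j hj] with p h1 h2 h3 h4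
    have hM0 : 0 ≤ M := (abs_nonneg _).trans h1
    have hB0 : 0 ≤ B := (abs_nonneg _).trans h3
    rw [Real.norm_eq_abs, abs_mul, abs_mul, abs_mul]
    gcongr
  have hsq : (fun p => (∑ i ∈ foldIndices K k n, W i p * X i p) ^ 2) = fun p =>
      ∑ i ∈ foldIndices K k n, ∑ j ∈ foldIndices K k n,
        (W i p * X i p) * (W j p * X j p) := by
    funext p
    rw [sq, Finset.sum_mul_sum]
  have hint1 : ∀ i ∈ foldIndices K k n,
      Integrable (fun p => ∑ j ∈ foldIndices K k n,
        (W i p * X i p) * (W j p * X j p)) (evalLaw γ P ν n) := by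
    intro i hi
    refine integrable_finsetSum _ fun j hj => hint i j ?_ ?_
    · exact mem_foldIndices.1 hi
    · exact mem_foldIndices.1 hj
  have hW2 : ∀ i, Integrable (fun p => W i p ^ 2) (evalLaw γ P ν n) := by
    intro i
    refine Integrable.of_bound (by fun_prop) (M ^ 2) ?_
    filter_upwards [hWb i] with p h1
    rw [Real.norm_eq_abs, abs_pow]
    gcongr
  rw [hsq]
  refine ⟨integrable_finsetSum _ hint1, ?_⟩
  rw [integral_finsetSum _ hint1, integral_finsetSum _ fun i _ => hW2 i, Finset.mul_sum]
  have hcross : ∀ i ∈ foldIndices K k n,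
      ∫ p, ∑ j ∈ foldIndices K k n, (W i p * X i p) * (W j p * X j p)
        ∂(evalLaw γ P ν n) ≤ B ^ 2 * ∫ p, W i p ^ 2 ∂(evalLaw γ P ν n) := by
    intro i hi'
    have hi : (i : ℕ) % K = k := mem_foldIndices.1 hi'
    rw [integral_finsetSum _ fun j hj => hint i j hi (mem_foldIndices.1 hj),
      Finset.sum_eq_single_of_mem i hi']
    · rw [← integral_const_mul]
      refine integral_mono_ae (hint i i hi hi) ((hW2 i).const_mul _) ?_
      filter_upwards [hXb i hi] with p hp
      have h1 : X i p ^ 2 ≤ B ^ 2 := sq_le_sq' (abs_le.1 hp).1 (abs_le.1 hp).2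
      calc W i p * X i p * (W i p * X i p) = X i p ^ 2 * W i p ^ 2 := by ring
        _ ≤ _ := mul_le_mul_of_nonneg_right h1 (sq_nonneg _)
    · intro j hj' hji
      have hj : (j : ℕ) % K = k := mem_foldIndices.1 hj'
      have e : (fun p => W i p * X i p * (W j p * X j p)) =
          fun p => (W i p * (W j p * X j p)) * ξ (foldData K k p.1, p.1.2 i) := by
        funext p; simp only [hX]; ring
      have hij := hint i j hi hj
      rw [e] at hij ⊢
      refine integral_mul_eq_zero_of_condMean_zero γ P ν hi hξ0
        (H := fun p => W i p * (W j p * X j p)) ?_ hij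
      intro p x v v'
      simp only [hW, hX]
      rw [normalized_resample w i i p x v v', normalized_resample w i j p x v v',
        foldData_resample hi, foldData_resample hi]
      simp [resample, Function.update_of_ne hji]
  refine (Finset.sum_le_sum hcross).trans ?_
  refine Finset.sum_le_sum_of_subset_of_nonneg (Finset.subset_univ _) fun i _ _ => ?_
  exact mul_nonneg (sq_nonneg _) (integral_nonneg fun p => sq_nonneg _)

/-- Weighted sums over a fold of conditionally centred terms tend to zero in probability. -/
theorem tendsto_noise {K k : ℕ} (hw : w.IsMeasurable) (hS : StoneConditions P γ ν w)
    {ξ : ∀ n, (S × Training d n K k) × Obs d → ℝ} (hξ : ∀ n, Measurable (ξ n)) {B : ℝ}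
    (hξB : ∀ n, ∀ᵐ D ∂(sampleLaw γ P n), ∀ᵐ z ∂P, |ξ n (foldData K k D, z)| ≤ B)
    (hξ0 : ∀ n, ∀ᵐ D ∂(sampleLaw γ P n), ∀ᵐ x ∂P.fst,
      ∫ v, ξ n (foldData K k D, (x, v)) ∂(condLaw P x) = 0) {ε : ℝ} (hε : 0 < ε) :
    Tendsto (fun n => evalLaw γ P ν n {p | ε < |∑ i ∈ foldIndices K k n,
      w.normalized i p.1 p.2 * ξ n (foldData K k p.1, p.1.2 i)|}) atTop (𝓝 0) := by
  obtain ⟨M₀, hM₀⟩ := hS.sum_abs_bounded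
  obtain ⟨M, hM1, hM⟩ : ∃ M : ℝ, 0 < M ∧ ∀ n : ℕ, ∀ᵐ p ∂(evalLaw γ P ν n),
      ∑ i : Fin n, |w.normalized i p.1 p.2| ≤ M :=
    ⟨max M₀ 1, lt_max_of_lt_right one_pos, fun n => by
      filter_upwards [hM₀ n] with p hp using hp.trans (le_max_left _ _)⟩
  refine tendsto_measure_zero_of_real fun δ hδ => ?_
  -- `δ₁` bounds the largest weight and `δ₂` the probability that it is exceeded. Each contributes
  -- half of the final `ε ^ 2 * δ` in Chebyshev's inequality; `B ^ 2 + 1` keeps the denominators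
  -- positive.
  set δ₁ : ℝ := δ * ε ^ 2 / (2 * (B ^ 2 + 1) * M) with hδ₁
  set δ₂ : ℝ := δ * ε ^ 2 / (2 * (B ^ 2 + 1) * M ^ 2) with hδ₂
  have hδ₁0 : 0 < δ₁ := by positivity
  have hδ₂0 : 0 < δ₂ := by positivity
  filter_upwards [eventually_real_le (hS.max_tendsto_zero δ₁ hδ₁0) hδ₂0] with n hn
  set E : Set ((S × (Fin n → Obs d)) × Cov d) := {p | ∃ i : Fin n, δ₁ < |w.normalized i p.1 p.2|}
    with hE
  have hEm : MeasurableSet E := by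
    have : E = ⋃ i : Fin n, {p | δ₁ < |w.normalized i p.1 p.2|} := by ext; simp [hE]
    rw [this]
    refine MeasurableSet.iUnion fun i => ?_
    have := measurable_normalized (d := d) hw i
    exact measurableSet_lt (by fun_prop) (by fun_prop)
  -- Off `E` the sum of squares is at most `max |W_i| ∑ |W_i| ≤ δ₁ M`; on `E` the crude bound `(∑
  -- |W_i|)² ≤ M²` is used.
  have hWsum : ∫ p, ∑ i : Fin n, w.normalized i p.1 p.2 ^ 2 ∂(evalLaw γ P ν n) ≤
      δ₁ * M + M ^ 2 * δ₂ := by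
    have hle : ∀ᵐ p ∂(evalLaw γ P ν n), ∑ i : Fin n, w.normalized i p.1 p.2 ^ 2 ≤
        δ₁ * M + E.indicator (fun _ => M ^ 2) p := by
      filter_upwards [hM n] with p hp
      by_cases hpE : p ∈ E
      · rw [Set.indicator_of_mem hpE]
        have : ∑ i : Fin n, w.normalized i p.1 p.2 ^ 2 ≤ M ^ 2 := by
          calc ∑ i : Fin n, w.normalized i p.1 p.2 ^ 2
              = ∑ i : Fin n, |w.normalized i p.1 p.2| ^ 2 := by simp
            _ ≤ (∑ i : Fin n, |w.normalized i p.1 p.2|) ^ 2 :=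
                Finset.sum_sq_le_sq_sum_of_nonneg fun _ _ => abs_nonneg _
            _ ≤ M ^ 2 := by gcongr
        have : 0 ≤ δ₁ * M := by positivity
        linarith
      · rw [Set.indicator_of_notMem hpE, add_zero]
        have hsm : ∀ i : Fin n, |w.normalized i p.1 p.2| ≤ δ₁ := by
          intro i
          by_contra hcon
          exact hpE ⟨i, not_le.1 hcon⟩
        calc ∑ i : Fin n, w.normalized i p.1 p.2 ^ 2
            = ∑ i : Fin n, |w.normalized i p.1 p.2| * |w.normalized i p.1 p.2| := by simp [sq]
          _ ≤ ∑ i : Fin n, δ₁ * |w.normalized i p.1 p.2| :=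
              Finset.sum_le_sum fun i _ => mul_le_mul_of_nonneg_right (hsm i) (abs_nonneg _)
          _ = δ₁ * ∑ i : Fin n, |w.normalized i p.1 p.2| := by rw [Finset.mul_sum]
          _ ≤ δ₁ * M := by gcongr
    have hind : Integrable (E.indicator fun _ => M ^ 2) (evalLaw γ P ν n) :=
      (integrable_const _).indicator hEm
    have hrhs : Integrable (fun p => δ₁ * M + E.indicator (fun _ => M ^ 2) p) (evalLaw γ P ν n) :=
      (integrable_const _).add hind
    refine (integral_mono_of_nonneg (Eventually.of_forall fun p =>
      Finset.sum_nonneg fun i _ => sq_nonneg _) hrhs hle).trans ?_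
    rw [integral_add (integrable_const _) hind, integral_indicator hEm, setIntegral_const]
    simp only [integral_const, probReal_univ, smul_eq_mul, one_mul]
    rw [mul_comm _ (M ^ 2)]
    gcongr
  obtain ⟨hint, hle⟩ := integral_sq_le (ν := ν) hw (hM n) (hξ n) (hξB n) (hξ0 n)
  have hmarkov := mul_meas_ge_le_integral_of_nonneg
    (Eventually.of_forall fun p => sq_nonneg _) hint (ε ^ 2)
  have hsub : (evalLaw γ P ν n).real {p | ε < |∑ i ∈ foldIndices K k n,
      w.normalized i p.1 p.2 * ξ n (foldData K k p.1, p.1.2 i)|} ≤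
      (evalLaw γ P ν n).real {p | ε ^ 2 ≤ (∑ i ∈ foldIndices K k n,
      w.normalized i p.1 p.2 * ξ n (foldData K k p.1, p.1.2 i)) ^ 2} := by
    refine measureReal_mono fun p hp => ?_
    change ε ^ 2 ≤ _
    rw [← sq_abs (∑ i ∈ foldIndices K k n, _)]
    exact pow_le_pow_left₀ hε.le (le_of_lt hp) 2
  have hε2 : 0 < ε ^ 2 := by positivity
  have hfin : ε ^ 2 * (evalLaw γ P ν n).real {p | ε < |∑ i ∈ foldIndices K k n,
      w.normalized i p.1 p.2 * ξ n (foldData K k p.1, p.1.2 i)|} ≤ ε ^ 2 * δ := by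
    calc _ ≤ _ := mul_le_mul_of_nonneg_left hsub hε2.le
      _ ≤ _ := hmarkov
      _ ≤ _ := hle
      _ ≤ B ^ 2 * (δ₁ * M + M ^ 2 * δ₂) := by gcongr
      _ ≤ (B ^ 2 + 1) * (δ₁ * M + M ^ 2 * δ₂) := by
        gcongr; linarith
      _ = ε ^ 2 * δ := by
        rw [hδ₁, hδ₂]; field_simp; norm_num
  exact le_of_mul_le_mul_left hfin hε2

end weights

/-! ### Stone's theorem for the weights. -/

theorem evalLaw_fst_preimage {S : Type*} [MeasurableSpace S] {d : ℕ} {γ : ℕ → Measure S}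
    {P : Measure (Obs d)} {ν : Measure (Cov d)} [IsProbabilityMeasure ν] (n : ℕ) (B : Set (S × (Fin n → Obs d))) :
    evalLaw γ P ν n {p | p.1 ∈ B} = sampleLaw γ P n B := by
  have : {p : (S × (Fin n → Obs d)) × Cov d | p.1 ∈ B} = B ×ˢ Set.univ := by ext; simp
  rw [this, evalLaw, Measure.prod_prod, measure_univ, mul_one]

section stone

variable {S : Type*} [MeasurableSpace S] {d : ℕ} {γ : ℕ → Measure S}
  [∀ n, IsProbabilityMeasure (γ n)] {P : Measure (Obs d)} [IsProbabilityMeasure P]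
  {ν : Measure (Cov d)} [IsProbabilityMeasure ν] {w : Weights S d}

theorem evalLaw_snd_preimage (n : ℕ) (B : Set (Cov d)) :
    evalLaw γ P ν n {p | p.2 ∈ B} = ν B := by
  have : {p : (S × (Fin n → Obs d)) × Cov d | p.2 ∈ B} = Set.univ ×ˢ B := by ext; simp
  rw [this, evalLaw, Measure.prod_prod, measure_univ, one_mul]

theorem measurable_weighted (hw : w.IsMeasurable) {n : ℕ} {h : Cov d → ℝ≥0∞} (hh : Measurable h) :
    Measurable fun p : (S × (Fin n → Obs d)) × Cov d =>
      ∑ i : Fin n, ENNReal.ofReal |w.normalized i p.1 p.2| * h (p.1.2 i).1 := by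
  refine Finset.measurable_fun_sum _ fun i _ => ?_
  have := measurable_normalized (d := d) hw i
  fun_prop

/-- The law of the evaluation point is dominated by the law of the covariates. -/
theorem evalPoint_le (hw : w.IsMeasurable) (hS : StoneConditions P γ ν w) {C : ℝ≥0}
    (hC : ∀ (n : ℕ) (h : Cov d → ℝ≥0∞), Measurable h →
      ∫⁻ p, ∑ i : Fin n, ENNReal.ofReal |w.normalized i p.1 p.2| * h (p.1.2 i).1
        ∂(evalLaw γ P ν n) ≤ C * ∫⁻ x, h x ∂P.fst) {B : Set (Cov d)} (hB : MeasurableSet B) :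
    ν B ≤ 2 * C * P.fst B := by
  -- If the evaluation point lies in `F`, the weights sum to nearly `1` and sit mostly within
  -- distance `r`, so the `r`-thickening of `F` receives absolute weight at least `1 - 1/4 - 1/4 =
  -- 1/2`. Markov's inequality and domination give the constant `2C` for the thickening; then `r →
  -- 0`, and inner regularity passes from closed to Borel sets.
  have hclosed : ∀ F : Set (Cov d), IsClosed F → ν F ≤ 2 * C * P.fst F := by
    intro F hF
    have hthick : ∀ r : ℝ, 0 < r → ν F ≤ 2 * C * P.fst (Metric.cthickening r F) := by
      intro r hr
      have h1 := hS.sum_tendsto_one (1 / 4) (by norm_num)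
      have h2 := hS.localized r hr (1 / 4) (by norm_num)
      have h3 := (tendsto_const_nhds (x := 2 * C * P.fst (Metric.cthickening r F))).add (h1.add h2)
      rw [add_zero, add_zero] at h3
      refine ge_of_tendsto h3 (Eventually.of_forall fun n => ?_)
      set b1 : Set ((S × (Fin n → Obs d)) × Cov d) :=
        {p | 1 / 4 < |(∑ i : Fin n, w.normalized i p.1 p.2) - 1|} with hb1
      set b2 : Set ((S × (Fin n → Obs d)) × Cov d) := {p | 1 / 4 < ∑ i : Fin n,
        Set.indicator {u : Cov d | r < ‖u - p.2‖} (fun _ => |w.normalized i p.1 p.2|) (p.1.2 i).1}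
        with hb2
      set h : Cov d → ℝ≥0∞ := (Metric.cthickening r F).indicator 1 with hh
      have hcm : MeasurableSet (Metric.cthickening r F) :=
        Metric.isClosed_cthickening.measurableSet
      have hhm : Measurable h := measurable_one.indicator hcm
      set b3 : Set ((S × (Fin n → Obs d)) × Cov d) := {p | (1 / 2 : ℝ≥0∞) ≤
        ∑ i : Fin n, ENNReal.ofReal |w.normalized i p.1 p.2| * h (p.1.2 i).1} with hb3
      have hm3 : evalLaw γ P ν n b3 ≤ 2 * C * P.fst (Metric.cthickening r F) := by
        have := mul_meas_ge_le_lintegral (μ := evalLaw γ P ν n)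
          (measurable_weighted (n := n) hw hhm) (1 / 2)
        have h4 := this.trans (hC n h hhm)
        rw [hh, lintegral_indicator_one hcm] at h4
        calc evalLaw γ P ν n b3 = 2 * (1 / 2 * evalLaw γ P ν n b3) := by
              rw [← mul_assoc, one_div, ENNReal.mul_inv_cancel (by simp) (by simp), one_mul]
          _ ≤ 2 * (C * P.fst (Metric.cthickening r F)) := by gcongr
          _ = _ := by rw [mul_assoc]
      have hsub : {p : (S × (Fin n → Obs d)) × Cov d | p.2 ∈ F} ⊆ b3 ∪ (b1 ∪ b2) := by
        intro p hp
        by_contra hcon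
        simp only [Set.mem_union, not_or] at hcon
        obtain ⟨n3, n1, n2⟩ := hcon
        apply n3
        have n1' : |(∑ i : Fin n, w.normalized i p.1 p.2) - 1| ≤ 1 / 4 := not_lt.1 n1
        have n2' : ∑ i : Fin n, Set.indicator {u : Cov d | r < ‖u - p.2‖}
          (fun _ => |w.normalized i p.1 p.2|) (p.1.2 i).1 ≤ 1 / 4 := not_lt.1 n2
        have key : ∀ i : Fin n, |w.normalized i p.1 p.2| ≤
            |w.normalized i p.1 p.2| * (Metric.cthickening r F).indicator 1 (p.1.2 i).1 +
            Set.indicator {u : Cov d | r < ‖u - p.2‖}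
              (fun _ => |w.normalized i p.1 p.2|) (p.1.2 i).1 := by
          intro i
          by_cases hi : r < ‖(p.1.2 i).1 - p.2‖
          · rw [Set.indicator_of_mem (s := {u : Cov d | r < ‖u - p.2‖}) hi]
            refine le_add_of_nonneg_left (mul_nonneg (abs_nonneg _) ?_)
            exact Set.indicator_nonneg (fun _ _ => zero_le_one) _
          · have hmem : (p.1.2 i).1 ∈ Metric.cthickening r F :=
              Metric.mem_cthickening_of_dist_le _ p.2 r F hp (by
                rw [dist_eq_norm]; exact not_lt.1 hi)
            rw [Set.indicator_of_mem hmem, Pi.one_apply, mul_one]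
            exact le_add_of_nonneg_right (Set.indicator_nonneg (fun _ _ => abs_nonneg _) _)
        have h5 := Finset.sum_le_sum fun i (_ : i ∈ Finset.univ) => key i
        rw [Finset.sum_add_distrib] at h5
        have h6 : ∑ i : Fin n, w.normalized i p.1 p.2 ≤ ∑ i : Fin n, |w.normalized i p.1 p.2| :=
          Finset.sum_le_sum fun i _ => le_abs_self _
        have h7 : (1 / 2 : ℝ) ≤ ∑ i : Fin n, |w.normalized i p.1 p.2| *
            (Metric.cthickening r F).indicator 1 (p.1.2 i).1 := by
          linarith [(abs_le.1 n1').1]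
        have h8 := ENNReal.ofReal_le_ofReal h7
        have h10 : ∀ i ∈ Finset.univ, 0 ≤ |w.normalized i p.1 p.2| *
            (Metric.cthickening r F).indicator (1 : Cov d → ℝ) (p.1.2 i).1 := fun i _ =>
          mul_nonneg (abs_nonneg _) (Set.indicator_nonneg (fun _ _ => zero_le_one) _)
        rw [ENNReal.ofReal_sum_of_nonneg h10] at h8
        have h9 : ENNReal.ofReal (1 / 2) = 1 / 2 := by
          rw [ENNReal.ofReal_div_of_pos (by norm_num)]; simp
        rw [h9] at h8
        refine h8.trans (le_of_eq (Finset.sum_congr rfl fun i _ => ?_))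
        rw [ENNReal.ofReal_mul (abs_nonneg _), hh]
        by_cases hi : (p.1.2 i).1 ∈ Metric.cthickening r F <;> simp [hi]
      calc ν F = evalLaw γ P ν n {p | p.2 ∈ F} := (evalLaw_snd_preimage n F).symm
        _ ≤ evalLaw γ P ν n (b3 ∪ (b1 ∪ b2)) := measure_mono hsub
        _ ≤ evalLaw γ P ν n b3 + (evalLaw γ P ν n b1 + evalLaw γ P ν n b2) :=
          (measure_union_le _ _).trans (by gcongr; exact measure_union_le _ _)
        _ ≤ _ := by gcongr
    have hlim : Tendsto (fun r => P.fst (Metric.cthickening r F)) (𝓝[>] 0) (𝓝 (P.fst F)) :=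
      (tendsto_measure_cthickening_of_isClosed ⟨1, one_pos, measure_ne_top _ _⟩ hF).mono_left
        nhdsWithin_le_nhds
    refine ge_of_tendsto (ENNReal.Tendsto.const_mul hlim (Or.inr (by finiteness))) ?_
    filter_upwards [self_mem_nhdsWithin] with r hr using hthick r hr
  rw [hB.measure_eq_iSup_isClosed_of_ne_top (measure_ne_top _ _)]
  refine iSup₂_le fun F hFB => iSup_le fun hF => (hclosed F hF).trans ?_
  gcongr

/-- Carries the `P_X`-almost sure regularity of the observed law over to the evaluation point. -/
theorem evalPoint_absolutelyContinuous (hw : w.IsMeasurable) (hS : StoneConditions P γ ν w) :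
    ν ≪ P.fst := by
  obtain ⟨C, hC⟩ := hS.dominated
  refine Measure.AbsolutelyContinuous.mk fun B hB h0 => ?_
  have := evalPoint_le hw hS hC hB
  rw [h0, mul_zero] at this
  exact le_antisymm this bot_le

/-- Stone's theorem: weighted averages of an integrable function of the covariates are consistent. -/
theorem tendsto_weighted_average (hw : w.IsMeasurable) (hS : StoneConditions P γ ν w)
    {g : Cov d → ℝ} (hgm : Measurable g) (hg : Integrable g P.fst) {ε : ℝ} (hε : 0 < ε) :
    Tendsto (fun n => evalLaw γ P ν n {p | ε < |(∑ i : Fin n, w.normalized i p.1 p.2 *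
      g (p.1.2 i).1) - g p.2|}) atTop (𝓝 0) := by
  obtain ⟨C, hC⟩ := hS.dominated
  obtain ⟨M₀, hM₀⟩ := hS.sum_abs_bounded
  obtain ⟨M, hM1, hM⟩ : ∃ M : ℝ, 0 < M ∧ ∀ n : ℕ, ∀ᵐ p ∂(evalLaw γ P ν n),
      ∑ i : Fin n, |w.normalized i p.1 p.2| ≤ M :=
    ⟨max M₀ 1, lt_max_of_lt_right one_pos, fun n => by
      filter_upwards [hM₀ n] with p hp using hp.trans (le_max_left _ _)⟩
  rw [ENNReal.tendsto_nhds_zero]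
  intro δ hδ
  -- Five shares of the error: one for the weighted average of `g - h`, one for `g - h` at the
  -- evaluation point, two for the variation of `h` (near and far observations), one for the total
  -- weight not being `1`.
  set ε' : ℝ := ε / 5 with hε'
  have hε'0 : 0 < ε' := by positivity
  have hεE : ENNReal.ofReal ε' ≠ 0 := by simpa using hε'0
  have hεT : ENNReal.ofReal ε' ≠ ∞ := ENNReal.ofReal_ne_top
  -- `θ` is the `L¹` distance allowed between `g` and its continuous, compactly supported
  -- approximation `h`. The factor `3` adds `C` from the domination of the weighted sum and `2C`
  -- from `evalPoint_le`.
  obtain ⟨θ, hθ0, hθ⟩ : ∃ θ : ℝ≥0∞, θ ≠ 0 ∧ 3 * C * θ / ENNReal.ofReal ε' ≤ δ / 2 := by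
    have hlim : Tendsto (fun θ : ℝ≥0∞ => 3 * C * θ / ENNReal.ofReal ε') (𝓝 0) (𝓝 0) := by
      have h1 : Tendsto (fun θ : ℝ≥0∞ => 3 * C * θ / ENNReal.ofReal ε') (𝓝 0)
          (𝓝 (3 * C * 0 / ENNReal.ofReal ε')) :=
        ENNReal.Tendsto.div_const (ENNReal.Tendsto.const_mul tendsto_id
          (Or.inr (by finiteness))) (Or.inr hεE)
      simpa using h1
    have hev := (ENNReal.tendsto_nhds_zero.1 hlim) (δ / 2) (ENNReal.half_pos hδ.ne')
    obtain ⟨a, ha, hsub⟩ := (ENNReal.nhds_zero_basis_Iic).mem_iff.1 hev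
    exact ⟨a, ha.ne', hsub (Set.mem_Iic.2 le_rfl)⟩
  obtain ⟨h, hcomp, hle, hcont, hint⟩ := hg.exists_hasCompactSupport_lintegral_sub_le hθ0
  obtain ⟨Bd, hBd⟩ := hcont.bounded_above_of_compact_support hcomp
  obtain ⟨B, hB0, hB⟩ : ∃ B : ℝ, 0 < B ∧ ∀ x, |h x| ≤ B :=
    ⟨max Bd 1, lt_max_of_lt_right one_pos, fun x => (hBd x).trans (le_max_left _ _)⟩
  have hunif := hcomp.uniformContinuous_of_continuous hcont
  obtain ⟨r₀, hr₀, hr⟩ := Metric.uniformContinuous_iff.1 hunif (ε' / M) (by positivity)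
  set r : ℝ := r₀ / 2 with hrdef
  have hr0 : 0 < r := by positivity
  have hrh : ∀ u v : Cov d, ‖u - v‖ ≤ r → |h u - h v| ≤ ε' / M := by
    intro u v huv
    have := hr (a := u) (b := v) (by rw [dist_eq_norm]; linarith)
    rw [Real.dist_eq] at this
    exact this.le
  set k : Cov d → ℝ≥0∞ := fun x => ‖g x - h x‖ₑ with hk
  have hkm : Measurable k := (hgm.sub hcont.measurable).enorm
  have e1 := ENNReal.tendsto_nhds_zero.1 (hS.localized r hr0 (ε' / (2 * B)) (by positivity))
    (δ / 2 / 2) (ENNReal.half_pos (ENNReal.half_pos hδ.ne').ne')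
  have e2 := ENNReal.tendsto_nhds_zero.1 (hS.sum_tendsto_one (ε' / B) (by positivity))
    (δ / 2 / 2) (ENNReal.half_pos (ENNReal.half_pos hδ.ne').ne')
  filter_upwards [e1, e2] with n hn1 hn2
  set b1 : Set ((S × (Fin n → Obs d)) × Cov d) := {p | ε' / (2 * B) < ∑ i : Fin n,
      Set.indicator {u : Cov d | r < ‖u - p.2‖} (fun _ => |w.normalized i p.1 p.2|) (p.1.2 i).1}
    with hb1
  set b2 : Set ((S × (Fin n → Obs d)) × Cov d) :=
    {p | ε' / B < |(∑ i : Fin n, w.normalized i p.1 p.2) - 1|} with hb2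
  set b3 : Set ((S × (Fin n → Obs d)) × Cov d) := {p | ENNReal.ofReal ε' ≤
    ∑ i : Fin n, ENNReal.ofReal |w.normalized i p.1 p.2| * k (p.1.2 i).1} with hb3
  set b4 : Set (Cov d) := {x | ENNReal.ofReal ε' ≤ k x} with hb4
  have hb4m : MeasurableSet b4 := measurableSet_le measurable_const hkm
  have m3 : evalLaw γ P ν n b3 ≤ C * θ / ENNReal.ofReal ε' := by
    refine (meas_ge_le_lintegral_div (measurable_weighted (n := n) hw hkm).aemeasurable
      hεE hεT).trans ?_
    gcongr
    exact (hC n k hkm).trans (by gcongr)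
  have m4 : evalLaw γ P ν n {p | p.2 ∈ b4} ≤ 2 * C * θ / ENNReal.ofReal ε' := by
    rw [evalLaw_snd_preimage]
    refine (evalPoint_le hw hS hC hb4m).trans ?_
    rw [mul_div_assoc]
    gcongr
    refine (meas_ge_le_lintegral_div hkm.aemeasurable hεE hεT).trans ?_
    gcongr
  have hsub : ({p : (S × (Fin n → Obs d)) × Cov d | ε < |(∑ i : Fin n, w.normalized i p.1 p.2 *
      g (p.1.2 i).1) - g p.2|} : Set _) ≤ᵐ[evalLaw γ P ν n]
        (((b3 ∪ {p | p.2 ∈ b4}) ∪ (b1 ∪ b2) : Set _)) := by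
    filter_upwards [hM n] with p hp hpε
    by_contra hcon
    have hcon' : ¬ (p ∈ (b3 ∪ {p | p.2 ∈ b4}) ∪ (b1 ∪ b2)) := hcon
    simp only [Set.mem_union, not_or] at hcon'
    obtain ⟨⟨n3, n4⟩, n1, n2⟩ := hcon'
    have n1' : ∑ i : Fin n, Set.indicator {u : Cov d | r < ‖u - p.2‖}
      (fun _ => |w.normalized i p.1 p.2|) (p.1.2 i).1 ≤ ε' / (2 * B) := not_lt.1 n1
    have n2' : |(∑ i : Fin n, w.normalized i p.1 p.2) - 1| ≤ ε' / B := not_lt.1 n2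
    have n3' : ∑ i : Fin n, |w.normalized i p.1 p.2| * |g (p.1.2 i).1 - h (p.1.2 i).1| < ε' := by
      have : ∑ i : Fin n, ENNReal.ofReal |w.normalized i p.1 p.2| * k (p.1.2 i).1 <
        ENNReal.ofReal ε' := not_le.1 n3
      have h2 : ∑ i : Fin n, ENNReal.ofReal |w.normalized i p.1 p.2| * k (p.1.2 i).1 =
          ENNReal.ofReal (∑ i : Fin n, |w.normalized i p.1 p.2| *
            |g (p.1.2 i).1 - h (p.1.2 i).1|) := by
        rw [ENNReal.ofReal_sum_of_nonneg fun i _ => mul_nonneg (abs_nonneg _) (abs_nonneg _)]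
        refine Finset.sum_congr rfl fun i _ => ?_
        simp only [ENNReal.ofReal_mul (abs_nonneg _), hk, Real.enorm_eq_ofReal_abs]
      rw [h2] at this
      exact (ENNReal.ofReal_lt_ofReal_iff hε'0).1 this
    have n4' : |g p.2 - h p.2| < ε' := by
      have : k p.2 < ENNReal.ofReal ε' := not_le.1 n4
      simp only [hk, Real.enorm_eq_ofReal_abs] at this
      exact (ENNReal.ofReal_lt_ofReal_iff hε'0).1 this
    have t3 : |∑ i : Fin n, w.normalized i p.1 p.2 * (g (p.1.2 i).1 - h (p.1.2 i).1)| < ε' := by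
      refine lt_of_le_of_lt (Finset.abs_sum_le_sum_abs _ _) ?_
      simpa only [abs_mul] using n3'
    have t1 : |∑ i : Fin n, w.normalized i p.1 p.2 * (h (p.1.2 i).1 - h p.2)| ≤ ε' + ε' := by
      have key : ∀ i : Fin n, |w.normalized i p.1 p.2 * (h (p.1.2 i).1 - h p.2)| ≤
          ε' / M * |w.normalized i p.1 p.2| + 2 * B * Set.indicator {u : Cov d | r < ‖u - p.2‖}
            (fun _ => |w.normalized i p.1 p.2|) (p.1.2 i).1 := by
        intro i
        rw [abs_mul]
        by_cases hi : r < ‖(p.1.2 i).1 - p.2‖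
        · rw [Set.indicator_of_mem (s := {u : Cov d | r < ‖u - p.2‖}) hi]
          have : |h (p.1.2 i).1 - h p.2| ≤ 2 * B :=
            (abs_sub _ _).trans (by linarith [hB (p.1.2 i).1, hB p.2])
          have h3 : 0 ≤ ε' / M * |w.normalized i p.1 p.2| := by positivity
          nlinarith [abs_nonneg (w.normalized i p.1 p.2)]
        · rw [Set.indicator_of_notMem (s := {u : Cov d | r < ‖u - p.2‖}) hi, mul_zero, add_zero,
            mul_comm]
          exact mul_le_mul_of_nonneg_right (hrh _ _ (not_lt.1 hi)) (abs_nonneg _)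
      refine (Finset.abs_sum_le_sum_abs _ _).trans
        ((Finset.sum_le_sum fun i _ => key i).trans ?_)
      rw [Finset.sum_add_distrib, ← Finset.mul_sum, ← Finset.mul_sum]
      refine add_le_add ?_ ?_
      · calc ε' / M * ∑ i : Fin n, |w.normalized i p.1 p.2| ≤ ε' / M * M := by gcongr
          _ = ε' := by field_simp
      · rw [le_div_iff₀ (by positivity)] at n1'
        linarith
    have t2 : |h p.2 * ((∑ i : Fin n, w.normalized i p.1 p.2) - 1)| ≤ ε' := by
      rw [abs_mul]
      calc |h p.2| * |(∑ i : Fin n, w.normalized i p.1 p.2) - 1| ≤ B * (ε' / B) := by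
            gcongr; exact hB _
        _ = ε' := by field_simp
    have hid : (∑ i : Fin n, w.normalized i p.1 p.2 * g (p.1.2 i).1) - g p.2 =
        (∑ i : Fin n, w.normalized i p.1 p.2 * (g (p.1.2 i).1 - h (p.1.2 i).1)) +
        (∑ i : Fin n, w.normalized i p.1 p.2 * (h (p.1.2 i).1 - h p.2)) +
        h p.2 * ((∑ i : Fin n, w.normalized i p.1 p.2) - 1) - (g p.2 - h p.2) := by
      simp only [mul_sub, Finset.sum_sub_distrib, ← Finset.sum_mul]
      ring
    have hpε' : ε < |(∑ i : Fin n, w.normalized i p.1 p.2 * g (p.1.2 i).1) - g p.2| := hpε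
    rw [hid] at hpε'
    rw [abs_lt] at t3 n4'
    rw [abs_le] at t1 t2
    rw [lt_abs] at hpε'
    rcases hpε' with hh | hh <;> linarith [t3.1, t3.2, n4'.1, n4'.2, t1.1, t1.2, t2.1, t2.2]
  calc _ ≤ evalLaw γ P ν n ((b3 ∪ {p | p.2 ∈ b4}) ∪ (b1 ∪ b2)) := measure_mono_ae hsub
    _ ≤ (evalLaw γ P ν n b3 + evalLaw γ P ν n {p | p.2 ∈ b4}) +
        (evalLaw γ P ν n b1 + evalLaw γ P ν n b2) :=
      (measure_union_le _ _).trans (add_le_add (measure_union_le _ _) (measure_union_le _ _))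
    _ ≤ (C * θ / ENNReal.ofReal ε' + 2 * C * θ / ENNReal.ofReal ε') + (δ / 2 / 2 + δ / 2 / 2) := by
      gcongr
    _ = 3 * C * θ / ENNReal.ofReal ε' + δ / 2 := by
      rw [ENNReal.add_halves, ← ENNReal.add_div]
      congr 2
      ring
    _ ≤ δ / 2 + δ / 2 := by gcongr
    _ = δ := ENNReal.add_halves δ

end stone

/-! ### The pseudo-outcome for the CATE and its conditional mean. -/

/-- The conditional mean of the pseudo-outcome `φ_τ^±` with nuisances `η` given `X = x`. -/
noncomputable def pseudoMean {d : ℕ} (Λ : ℝ) (P : Measure (Obs d)) [IsProbabilityMeasure P]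
    (s : Side) (η : Nuisance d) (x : Cov d) : ℝ :=
  meanArm Λ (condLaw P x) (s.arm true) true (armScore true (η.e x)) (η.q (s.arm true) x true)
      (η.ρ (s.arm true) x true) -
    meanArm Λ (condLaw P x) (s.arm false) false (armScore false (η.e x))
      (η.q (s.arm false) x false) (η.ρ (s.arm false) x false)

/-- Overlap and boundedness of nuisances at a covariate value. -/
def Nuisance.BoundedAt {d : ℕ} (η : Nuisance d) (s : Side) (ε C : ℝ) (x : Cov d) : Prop :=
  ∀ a : Bool, ε ≤ armScore a (η.e x) ∧ armScore a (η.e x) ≤ 1 ∧ |η.q (s.arm a) x a| ≤ C ∧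
    |η.ρ (s.arm a) x a| ≤ C

/-- Overlap and boundedness of the conditional law of `(A, Y)` at a covariate value. -/
def RegularAt {d : ℕ} (P : Measure (Obs d)) [IsProbabilityMeasure P] (C : ℝ) (x : Cov d) : Prop :=
  0 < propensity P x ∧ propensity P x < 1 ∧ ∀ᵐ v ∂(condLaw P x), |v.2| ≤ C

theorem integral_pseudoCate {d : ℕ} {Λ : ℝ} (hΛ : 1 ≤ Λ) (P : Measure (Obs d))
    [IsProbabilityMeasure P] (s : Side) (η : Nuisance d) {C : ℝ} {x : Cov d}
    (hx : RegularAt P C x) :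
    Integrable (fun v => pseudoCate Λ s (x, v) η) (condLaw P x) ∧
      ∫ v, pseudoCate Λ s (x, v) η ∂(condLaw P x) = pseudoMean Λ P s η x := by
  have h1 := integral_pseudoArm hΛ hx.2.2 (s.arm true) true (armScore true (η.e x))
    (η.q (s.arm true) x true) (η.ρ (s.arm true) x true)
  have h0 := integral_pseudoArm hΛ hx.2.2 (s.arm false) false (armScore false (η.e x))
    (η.q (s.arm false) x false) (η.ρ (s.arm false) x false)
  simp only [pseudoCate_eq]
  refine ⟨h1.1.sub h0.1, ?_⟩
  rw [integral_sub h1.1 h0.1, h1.2, h0.2]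
  rfl

theorem abs_pseudoCate_le {d : ℕ} {Λ : ℝ} (hΛ : 1 ≤ Λ) (s : Side) {z : Obs d} {η : Nuisance d}
    {ε C : ℝ} (hε : 0 < ε) (hη : η.BoundedAt s ε C z.1) (hz : |z.2.2| ≤ C) :
    |pseudoCate Λ s z η| ≤ 2 * (C + 1 / ε * ((2 * Λ + 5) * C + C)) := by
  rw [pseudoCate_eq, two_mul]
  exact (abs_sub _ _).trans (add_le_add
    (abs_pseudoArm_le hΛ _ _ hε (hη true).1 (hη true).2.1 hz (hη true).2.2.1 (hη true).2.2.2)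
    (abs_pseudoArm_le hΛ _ _ hε (hη false).1 (hη false).2.1 hz (hη false).2.2.1 (hη false).2.2.2))

theorem abs_pseudoMean_le {d : ℕ} {Λ : ℝ} (hΛ : 1 ≤ Λ) (P : Measure (Obs d))
    [IsProbabilityMeasure P] (s : Side) {η : Nuisance d} {ε C : ℝ} {x : Cov d} (hε : 0 < ε)
    (hη : η.BoundedAt s ε C x) (hx : RegularAt P C x) :
    |pseudoMean Λ P s η x| ≤ 2 * (C + 1 / ε * ((2 * Λ + 5) * C + C)) := by
  rw [← (integral_pseudoCate hΛ P s η hx).2]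
  have : ∀ᵐ v ∂(condLaw P x), ‖pseudoCate Λ s (x, v) η‖ ≤
      2 * (C + 1 / ε * ((2 * Λ + 5) * C + C)) := by
    filter_upwards [hx.2.2] with v hv
    exact abs_pseudoCate_le hΛ s (z := (x, v)) hε hη hv
  simpa using norm_integral_le_of_norm_le_const this

theorem armProb_condLaw {d : ℕ} (P : Measure (Obs d)) [IsProbabilityMeasure P] (x : Cov d)
    (a : Bool) : armProb (condLaw P x) a = armScore a (propensity P x) := by
  cases a
  · rw [armProb_false]; rfl
  · rfl

theorem abs_armScore_sub (a : Bool) (e e' : ℝ) : |armScore a e - armScore a e'| = |e - e'| := by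
  cases a
  · simp only [armScore, Bool.false_eq_true, if_false]
    rw [← abs_neg]; ring_nf
  · simp [armScore]

theorem RegularAt.armProb_pos {d : ℕ} {P : Measure (Obs d)} [IsProbabilityMeasure P] {C : ℝ}
    {x : Cov d} (hx : RegularAt P C x) (a : Bool) : 0 < armProb (condLaw P x) a :=
  BLearner.armProb_pos hx.1 hx.2.1 a

theorem abs_pseudoMean_sub_putativeBound_le {d : ℕ} {Λ : ℝ} (hΛ : 1 ≤ Λ) (P : Measure (Obs d))
    [IsProbabilityMeasure P] (s : Side) {η : Nuisance d} {ε C δ : ℝ} {x : Cov d} (hε : 0 < ε)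
    (hη : η.BoundedAt s ε C x) (hx : RegularAt P C x) {q : Bool → ℝ}
    (hq : ∀ a, |η.q (s.arm a) x a - q a| ≤ δ)
    (hor : |η.e x - propensity P x| ≤ δ ∨
      ∀ a, |η.ρ (s.arm a) x a - modifiedRegression Λ P (s.arm a) x a (q a)| ≤ δ) :
    |pseudoMean Λ P s η x - putativeBound Λ (condLaw P x) s q| ≤
      2 * (((Λ + 2) + ((2 * Λ + 6) * C + (Λ + 3)) / ε) * δ) := by
  have key := fun a => abs_meanArm_sub_armBound_le hΛ hx.2.2 (s.arm a) a (hx.armProb_pos a) hε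
    (hη a).1 (hη a).2.1 (hη a).2.2.1 (hη a).2.2.2 (hq a) (by
      rcases hor with h | h
      · left; rw [armProb_condLaw, abs_armScore_sub]; exact h
      · right; rw [← modifiedRegression_eq]; exact h a)
  have h1 := key true
  have h0 := key false
  rw [abs_le] at h1 h0 ⊢
  unfold pseudoMean putativeBound
  constructor <;> linarith [h1.1, h1.2, h0.1, h0.2]

/-! ### Noise and bias within one fold. -/

section estimator

variable {S : Type*} [MeasurableSpace S] {d K : ℕ} {γ : ℕ → Measure S}
  [∀ n, IsProbabilityMeasure (γ n)] {P : Measure (Obs d)} [IsProbabilityMeasure P]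
  {ν : Measure (Cov d)} [IsProbabilityMeasure ν] {w : Weights S d} {η : NuisanceEst S d K}

theorem measurable_armScore (a : Bool) : Measurable (armScore a) := by
  cases a <;> (unfold armScore; simp only [Bool.false_eq_true, if_false, if_true]; fun_prop)

theorem measurable_pseudoCate (hη : η.IsMeasurable) (Λ : ℝ) (s : Side) (n k : ℕ) :
    Measurable fun t : (S × Training d n K k) × Obs d =>
      pseudoCate Λ s t.2 (η n k t.1.1 t.1.2) := by
  have hr : Measurable fun t : (S × Training d n K k) × Obs d => (t.1.1, t.1.2, t.2.1) := by
    fun_prop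
  simp only [pseudoCate_eq]
  have key := fun a => measurable_pseudoArm Λ (s.arm a) a
    (v := fun t : (S × Training d n K k) × Obs d => t.2.2) (by fun_prop)
    ((measurable_armScore a).comp ((hη.e n k).comp hr)) ((hη.q n k (s.arm a) a).comp hr)
    ((hη.ρ n k (s.arm a) a).comp hr)
  exact (key true).sub (key false)

theorem measurable_pseudoMean (hη : η.IsMeasurable) (Λ : ℝ) (s : Side) (n k : ℕ) :
    Measurable fun t : (S × Training d n K k) × Cov d =>
      pseudoMean Λ P s (η n k t.1.1 t.1.2) t.2 := by
  have hr : Measurable fun t : (S × Training d n K k) × Cov d => (t.1.1, t.1.2, t.2) := by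
    fun_prop
  have key := fun a => measurable_meanArm P Λ (s.arm a)
    (X := fun t : (S × Training d n K k) × Cov d => t.2) measurable_snd a
    ((measurable_armScore a).comp ((hη.e n k).comp hr)) ((hη.q n k (s.arm a) a).comp hr)
    ((hη.ρ n k (s.arm a) a).comp hr)
  exact (key true).sub (key false)

theorem measurable_propensity (P : Measure (Obs d)) [IsProbabilityMeasure P] :
    Measurable (propensity P) :=
  measurable_armProb P measurable_id true

theorem measurable_modifiedRegression (P : Measure (Obs d)) [IsProbabilityMeasure P] (Λ : ℝ)
    (s : Side) (a : Bool) {q : Cov d → ℝ} (hq : Measurable q) :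
    Measurable fun x => modifiedRegression Λ P s x a (q x) := by
  simp only [modifiedRegression_eq]
  exact (measurable_armModified P Λ s measurable_id a hq).div
    (measurable_armProb P measurable_id a)

/-- Subtracting the conditional mean given the covariate, at the nuisances fitted off the fold,
makes each summand centred in the sense `tendsto_noise` requires; boundedness comes from overlap. -/
theorem tendsto_centred_fold (hΛ : 1 ≤ Λ) (hw : w.IsMeasurable) (hS : StoneConditions P γ ν w)
    (hη : η.IsMeasurable) (s : Side) {k : ℕ} {ε₀ C : ℝ} (hε₀ : 0 < ε₀)
    (hY : ∀ᵐ z ∂P, |z.2.2| ≤ C) (hreg : ∀ᵐ x ∂P.fst, RegularAt P C x)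
    (hbd : ∀ n, ∀ᵐ D ∂(sampleLaw γ P n), ∀ᵐ x ∂P.fst, (η.fit n k D).BoundedAt s ε₀ C x)
    {ε : ℝ} (hε : 0 < ε) :
    Tendsto (fun n => evalLaw γ P ν n {p | ε < |∑ i ∈ foldIndices K k n,
      w.normalized i p.1 p.2 * (pseudoCate Λ s (p.1.2 i) (η.fit n k p.1) -
        pseudoMean Λ P s (η.fit n k p.1) (p.1.2 i).1)|}) atTop (𝓝 0) := by
  refine tendsto_noise (K := K) (k := k) hw hS (ξ := fun n t =>
    pseudoCate Λ s t.2 (η n k t.1.1 t.1.2) - pseudoMean Λ P s (η n k t.1.1 t.1.2) t.2.1)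
    (B := 2 * (2 * (C + 1 / ε₀ * ((2 * Λ + 5) * C + C)))) ?_ ?_ ?_ hε
  · intro n
    exact (measurable_pseudoCate hη Λ s n k).sub ((measurable_pseudoMean hη Λ s n k).comp
      (by fun_prop : Measurable fun t : (S × Training d n K k) × Obs d => (t.1, t.2.1)))
  · intro n
    filter_upwards [hbd n] with D hD
    filter_upwards [ae_of_ae_fst P hD, ae_of_ae_fst P hreg, hY] with z h1 h2 h3
    rw [two_mul (2 * _)]
    exact (abs_sub _ _).trans (add_le_add (abs_pseudoCate_le hΛ s hε₀ h1 h3)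
      (abs_pseudoMean_le hΛ P s hε₀ h1 h2))
  · intro n
    refine Eventually.of_forall fun D => ?_
    filter_upwards [hreg] with x hx
    have := integral_pseudoCate hΛ P s (η.fit n k D) hx
    change ∫ v, (pseudoCate Λ s (x, v) (η.fit n k D) - pseudoMean Λ P s (η.fit n k D) x)
      ∂(condLaw P x) = 0
    rw [integral_sub this.1 (integrable_const _), this.2]
    simp

/-- Uniform consistency carries over to the observations of the fold. -/
theorem tendsto_fold_of_unifConsistent {k : ℕ} {G : ∀ n, (S × Training d n K k) × Cov d → ℝ}
    (hG : ∀ n, Measurable (G n)) {g : Cov d → ℝ} (hg : Measurable g)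
    (hc : UnifConsistent P γ (fun n D x => G n (foldData K k D, x)) g) {δ : ℝ} (hδ : 0 < δ) :
    Tendsto (fun n => evalLaw γ P ν n {p | ¬ ∀ i ∈ foldIndices K k n,
      |G n (foldData K k p.1, (p.1.2 i).1) - g (p.1.2 i).1| ≤ δ}) atTop (𝓝 0) := by
  refine tendsto_of_tendsto_of_tendsto_of_le_of_le tendsto_const_nhds (hc δ hδ)
    (fun _ => bot_le) fun n => ?_
  change evalLaw γ P ν n _ ≤ sampleLaw γ P n _
  rw [← evalLaw_fst_preimage (γ := γ) (P := P) (ν := ν) n]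
  refine measure_mono_ae ?_
  have hset : MeasurableSet {t : (S × Training d n K k) × Cov d | |G n t - g t.2| ≤ δ} :=
    measurableSet_le ((hG n).sub (hg.comp measurable_snd)).abs measurable_const
  filter_upwards [ae_foldData_of_ae γ P ν hset] with p hp hbad hgood
  exact hbad fun i hi => hp hgood i (mem_foldIndices.1 hi)

/-- The double-robustness estimate is linear in the nuisance error with slope `L`, so errors below
`κ / L` at all observations of the fold suffice. Cross-fitting lets the uniform consistency over `x`
be evaluated at those observations. -/
theorem tendsto_bias_fold (hΛ : 1 ≤ Λ) (hη : η.IsMeasurable) (s : Side) {k : ℕ} {ε₀ C : ℝ}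
    (hε₀ : 0 < ε₀) (hC : 0 ≤ C) (hreg : ∀ᵐ x ∂P.fst, RegularAt P C x)
    (hbd : ∀ n, ∀ᵐ D ∂(sampleLaw γ P n), ∀ᵐ x ∂P.fst, (η.fit n k D).BoundedAt s ε₀ C x)
    {q : Bool → Cov d → ℝ} (hqm : ∀ a, Measurable (q a))
    (hq : ∀ a, UnifConsistent P γ (fun n D x => (η.fit n k D).q (s.arm a) x a) (q a))
    (hor : UnifConsistent P γ (fun n D x => (η.fit n k D).e x) (propensity P) ∨
      ∀ a, UnifConsistent P γ (fun n D x => (η.fit n k D).ρ (s.arm a) x a)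
        (fun x => modifiedRegression Λ P (s.arm a) x a (q a x)))
    {κ : ℝ} (hκ : 0 < κ) :
    Tendsto (fun n => evalLaw γ P ν n {p | ¬ ∀ i ∈ foldIndices K k n,
      |pseudoMean Λ P s (η.fit n k p.1) (p.1.2 i).1 -
        putativeBound Λ (condLaw P (p.1.2 i).1) s (fun a => q a (p.1.2 i).1)| ≤ κ})
      atTop (𝓝 0) := by
  set L : ℝ := 2 * ((Λ + 2) + ((2 * Λ + 6) * C + (Λ + 3)) / ε₀) with hL
  have hL0 : 0 < L := by positivity
  set δ : ℝ := κ / L with hδdef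
  have hδ : 0 < δ := by positivity
  have hLδ : L * δ = κ := by rw [hδdef]; field_simp
  have hr : ∀ n, Measurable fun t : (S × Training d n K k) × Cov d => (t.1.1, t.1.2, t.2) :=
    fun n => by fun_prop
  have hbd' : ∀ n, ∀ᵐ p ∂(evalLaw γ P ν n), ∀ i ∈ foldIndices K k n,
      (η.fit n k p.1).BoundedAt s ε₀ C (p.1.2 i).1 := by
    intro n
    have hset : MeasurableSet {t : (S × Training d n K k) × Cov d |
        (η n k t.1.1 t.1.2).BoundedAt s ε₀ C t.2} := by
      have h1 := fun a => (measurable_armScore a).comp ((hη.e n k).comp (hr n))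
      have h2 := fun a => (hη.q n k (s.arm a) a).comp (hr n)
      have h3 := fun a => (hη.ρ n k (s.arm a) a).comp (hr n)
      have : {t : (S × Training d n K k) × Cov d |
        (η n k t.1.1 t.1.2).BoundedAt s ε₀ C t.2} = ⋂ a : Bool, {t |
          ε₀ ≤ armScore a ((η n k t.1.1 t.1.2).e t.2) ∧ armScore a ((η n k t.1.1 t.1.2).e t.2) ≤ 1 ∧
          |(η n k t.1.1 t.1.2).q (s.arm a) t.2 a| ≤ C ∧
          |(η n k t.1.1 t.1.2).ρ (s.arm a) t.2 a| ≤ C} := by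
        ext t; simp only [Set.mem_iInter]; rfl
      rw [this]
      refine MeasurableSet.iInter fun a => ?_
      exact (measurableSet_le measurable_const (h1 a)).inter
        ((measurableSet_le (h1 a) measurable_const).inter
        ((measurableSet_le (h2 a).abs measurable_const).inter
        (measurableSet_le (h3 a).abs measurable_const)))
    have h4 : ∀ᵐ p ∂(evalLaw γ P ν n), ∀ᵐ x ∂P.fst, (η.fit n k p.1).BoundedAt s ε₀ C x :=
      Measure.quasiMeasurePreserving_fst.ae (hbd n)
    filter_upwards [ae_foldData_of_ae γ P ν hset, h4] with p hp hp4 i hi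
    exact hp hp4 i (mem_foldIndices.1 hi)
  have hreg' : ∀ n, ∀ᵐ p ∂(evalLaw γ P ν n), ∀ i : Fin n, RegularAt P C (p.1.2 i).1 :=
    fun n => ae_obs γ P ν (ae_of_ae_fst P hreg)
  have tq := fun a => tendsto_fold_of_unifConsistent (ν := ν) (K := K) (k := k)
    (G := fun n t => (η n k t.1.1 t.1.2).q (s.arm a) t.2 a)
    (fun n => (hη.q n k (s.arm a) a).comp (hr n)) (hqm a) (hq a) hδ
  -- `V n` is the exceptional event of whichever nuisance is consistent; the rest of the argument
  -- does not need to know which one it is.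
  obtain ⟨V, hV, hVor⟩ : ∃ V : ∀ n, Set ((S × (Fin n → Obs d)) × Cov d),
      Tendsto (fun n => evalLaw γ P ν n (V n)) atTop (𝓝 0) ∧
      ∀ n, ∀ p ∉ V n, ∀ i ∈ foldIndices K k n,
        (|(η.fit n k p.1).e (p.1.2 i).1 - propensity P (p.1.2 i).1| ≤ δ ∨
        ∀ a, |(η.fit n k p.1).ρ (s.arm a) (p.1.2 i).1 a -
          modifiedRegression Λ P (s.arm a) (p.1.2 i).1 a (q a (p.1.2 i).1)| ≤ δ) := by
    rcases hor with h | h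
    · exact ⟨_, tendsto_fold_of_unifConsistent (ν := ν) (K := K) (k := k)
        (G := fun n t => (η n k t.1.1 t.1.2).e t.2)
        (fun n => (hη.e n k).comp (hr n)) (measurable_propensity P) h hδ,
        fun n p hp i hi => Or.inl (not_not.1 hp i hi)⟩
    · have tρ := fun a => tendsto_fold_of_unifConsistent (ν := ν) (K := K) (k := k)
        (G := fun n t => (η n k t.1.1 t.1.2).ρ (s.arm a) t.2 a)
        (fun n => (hη.ρ n k (s.arm a) a).comp (hr n))
        (measurable_modifiedRegression P Λ (s.arm a) a (hqm a)) (h a) hδ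
      have hsum := (tρ true).add (tρ false)
      rw [add_zero] at hsum
      refine ⟨_, tendsto_of_tendsto_of_tendsto_of_le_of_le tendsto_const_nhds hsum
        (fun _ => bot_le) fun n => measure_union_le _ _, fun n p hp i hi => Or.inr fun a => ?_⟩
      have hp' := not_or.1 hp
      cases a
      · exact not_not.1 hp'.2 i hi
      · exact not_not.1 hp'.1 i hi
  have hsum := ((tq true).add (tq false)).add hV
  rw [add_zero, add_zero] at hsum
  refine tendsto_of_tendsto_of_tendsto_of_le_of_le tendsto_const_nhds hsum
    (fun _ => bot_le) fun n => ?_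
  refine le_trans (measure_mono_ae ?_) ((measure_union_le _ _).trans
    (add_le_add_left (measure_union_le _ _) _))
  filter_upwards [hbd' n, hreg' n] with p h1 h2 hbad
  by_contra hcon
  obtain ⟨hcon', n3⟩ := not_or.1 hcon
  obtain ⟨n1, n0⟩ := not_or.1 hcon'
  refine hbad fun i hi => ?_
  rw [← hLδ, hL, mul_assoc]
  refine abs_pseudoMean_sub_putativeBound_le hΛ P s hε₀ (h1 i hi) (h2 i)
    (q := fun a => q a (p.1.2 i).1) (fun a => ?_) (hVor n p n3 i hi)
  cases a
  · exact not_not.1 n0 i hi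
  · exact not_not.1 n1 i hi

end estimator

/-! ### Decomposition of the error and conclusion. -/

/-- Every index lies in exactly one residue class, so the sum may be regrouped by folds; adding and
subtracting the conditional mean and `g` at the observed covariates leaves noise, bias and smoothing
error. -/
theorem cateEstimator_eq {S : Type*} {d K : ℕ} {P : Measure (Obs d)} [IsProbabilityMeasure P]
    {w : Weights S d} {η : NuisanceEst S d K} (Λ : ℝ) (s : Side) (hK : 0 < K) {n : ℕ} (D : S × (Fin n → Obs d))
    (x : Cov d) (g : Cov d → ℝ) :
    cateEstimator Λ η w s D x - g x =
      (∑ k ∈ Finset.range K, ∑ i ∈ foldIndices K k n, w.normalized i D x *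
        (pseudoCate Λ s (D.2 i) (η.fit n k D) - pseudoMean Λ P s (η.fit n k D) (D.2 i).1)) +
      (∑ k ∈ Finset.range K, ∑ i ∈ foldIndices K k n, w.normalized i D x *
        (pseudoMean Λ P s (η.fit n k D) (D.2 i).1 - g (D.2 i).1)) +
      ((∑ i : Fin n, w.normalized i D x * g (D.2 i).1) - g x) := by
  have hfib : ∀ F : ℕ → Fin n → ℝ, ∑ k ∈ Finset.range K, ∑ i ∈ foldIndices K k n, F k i =
      ∑ i : Fin n, F ((i : ℕ) % K) i := by
    intro F
    rw [← Finset.sum_fiberwise_of_maps_to (s := Finset.univ) (t := Finset.range K)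
      (g := fun i : Fin n => (i : ℕ) % K)
      (fun i _ => Finset.mem_range.2 (Nat.mod_lt _ hK))]
    refine Finset.sum_congr rfl fun k _ => Finset.sum_congr rfl fun i hi => ?_
    rw [(Finset.mem_filter.1 hi).2]
  rw [hfib fun k i => w.normalized i D x *
      (pseudoCate Λ s (D.2 i) (η.fit n k D) - pseudoMean Λ P s (η.fit n k D) (D.2 i).1),
    hfib fun k i => w.normalized i D x *
      (pseudoMean Λ P s (η.fit n k D) (D.2 i).1 - g (D.2 i).1), ← add_sub_assoc,
    ← Finset.sum_add_distrib, ← Finset.sum_add_distrib]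
  congr 1
  unfold cateEstimator
  rw [Finset.mul_sum]
  refine Finset.sum_congr rfl fun i _ => ?_
  unfold Weights.normalized
  ring

theorem ae_regularAt {d : ℕ} {P : Measure (Obs d)} [IsProbabilityMeasure P] {ε₀ C : ℝ}
    (hε₀ : 0 < ε₀) (hprop : ∀ᵐ x ∂P.fst, ε₀ ≤ propensity P x ∧ propensity P x ≤ 1 - ε₀)
    (hY : ∀ᵐ z ∂P, |z.2.2| ≤ C) : ∀ᵐ x ∂P.fst, RegularAt P C x := by
  have h : ∀ᵐ x ∂P.fst, ∀ᵐ v ∂(condLaw P x), |v.2| ≤ C := by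
    rw [← P.disintegrate P.condKernel] at hY
    exact Measure.ae_ae_of_ae_compProd hY
  filter_upwards [hprop, h] with x h1 h2
  exact ⟨by linarith [h1.1], by linarith [h1.2], h2⟩

theorem ae_boundedAt {S : Type*} [MeasurableSpace S] {d K : ℕ} {Λ : ℝ} {P : Measure (Obs d)}
    [IsProbabilityMeasure P] {f : Cov d → Bool → ℝ → ℝ} {γ : ℕ → Measure S}
    {η : NuisanceEst S d K} {s : Side} {ε₀ C : ℝ} (hε₀ : 0 < ε₀)
    (h : ∀ n k : ℕ, k < K → ∀ᵐ D ∂(sampleLaw γ P n), ∀ᵐ x ∂P.fst,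
      (ε₀ ≤ (η.fit n k D).e x ∧ (η.fit n k D).e x ≤ 1 - ε₀) ∧
      ∀ t ∈ Set.Icc (0 : ℝ) 1, ∀ a : Bool,
        |((trueNuisance Λ P).mix t (η.fit n k D)).q (s.arm a) x a| ≤ C ∧
        |((trueNuisance Λ P).mix t (η.fit n k D)).ρ (s.arm a) x a| ≤ C ∧
        f x a (((trueNuisance Λ P).mix t (η.fit n k D)).q (s.arm a) x a) ≤ C)
    (n k : ℕ) (hk : k < K) :
    ∀ᵐ D ∂(sampleLaw γ P n), ∀ᵐ x ∂P.fst, (η.fit n k D).BoundedAt s ε₀ C x := by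
  filter_upwards [h n k hk] with D hD
  filter_upwards [hD] with x hx a
  -- The endpoint `t = 1` of the segment is the estimated nuisance itself.
  have h1 := hx.2 1 ⟨zero_le_one, le_rfl⟩ a
  simp only [Nuisance.mix, sub_self, zero_mul, one_mul, zero_add] at h1
  refine ⟨?_, ?_, h1.1, h1.2.1⟩
  · cases a <;> simp only [armScore, Bool.false_eq_true, if_false, if_true] <;>
      linarith [hx.1.1, hx.1.2]
  · cases a <;> simp only [armScore, Bool.false_eq_true, if_false, if_true] <;>
      linarith [hx.1.1, hx.1.2]

/-- Limits of uniformly bounded estimators are bounded. -/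
theorem ae_abs_le_of_unifConsistent {S : Type*} [MeasurableSpace S] {d : ℕ} {P : Measure (Obs d)}
    [IsProbabilityMeasure P] {γ : ℕ → Measure S} [∀ n, IsProbabilityMeasure (γ n)]
    {ghat : ∀ n : ℕ, S × (Fin n → Obs d) → Cov d → ℝ} {g : Cov d → ℝ} {C : ℝ}
    (hC : ∀ n, ∀ᵐ D ∂(sampleLaw γ P n), ∀ᵐ x ∂P.fst, |ghat n D x| ≤ C)
    (hc : UnifConsistent P γ ghat g) : ∀ᵐ x ∂P.fst, |g x| ≤ C + 1 := by
  obtain ⟨n, hn⟩ := ((hc 1 one_pos).eventually (gt_mem_nhds zero_lt_one)).exists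
  -- For one suitable `n` the bad event has probability below `1`, so some sample is both close to
  -- the limit and bounded; that single sample bounds `g`.
  have : ∃ᵐ D ∂(sampleLaw γ P n), ∀ᵐ x ∂P.fst, |ghat n D x - g x| ≤ 1 := by
    intro hcon
    have := (prob_compl_eq_zero_iff₀ (μ := sampleLaw γ P n)
      (s := {D | ¬ ∀ᵐ x ∂P.fst, |ghat n D x - g x| ≤ 1})
      (NullMeasurableSet.of_compl (NullMeasurableSet.of_null hcon))).1 hcon
    rw [this] at hn
    exact lt_irrefl _ hn
  obtain ⟨D, h1, h2⟩ := (this.and_eventually (hC n)).exists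
  filter_upwards [h1, h2] with x h3 h4
  rw [abs_le] at h3 h4 ⊢
  constructor <;> linarith [h3.1, h3.2, h4.1, h4.2]

end BLearner

theorem mainTheorem6 {d K : ℕ} (hK : 2 ≤ K) {S : Type*} [MeasurableSpace S]
    (Λ : ℝ) (hΛ : 1 ≤ Λ)
    -- the observed distribution and a version of the conditional outcome density
    (P : Measure (BLearner.Obs d)) [IsProbabilityMeasure P]
    (f : BLearner.Cov d → Bool → ℝ → ℝ) (hf : BLearner.IsCondDensity P f)
    -- the law of the auxiliary sample, the nuisance estimators and the weights
    (γ : ℕ → Measure S) [∀ n, IsProbabilityMeasure (γ n)]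
    (η : BLearner.NuisanceEst S d K) (hη : η.IsMeasurable)
    (w : BLearner.Weights S d) (hw : w.IsMeasurable)
    -- the law of the evaluation point
    (ν : Measure (BLearner.Cov d)) [IsProbabilityMeasure ν]
    (hStone : BLearner.StoneConditions P γ ν w)
    -- the sign of the bound
    (s : BLearner.Side)
    (hbdd : BLearner.BoundedNuisances Λ P f γ η s)
    -- the limits of the quantile estimators
    (qbar : BLearner.Side → BLearner.Cov d → Bool → ℝ)
    (hqbar : ∀ a : Bool, Measurable fun x => qbar (s.arm a) x a)
    (hq : ∀ k < K, ∀ a : Bool, BLearner.UnifConsistent P γ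
      (fun n D x => (η.fit n k D).q (s.arm a) x a) (fun x => qbar (s.arm a) x a))
    (hpos : ∀ᵐ x ∂P.fst, ∀ a : Bool, 0 < f x a (qbar (s.arm a) x a))
    -- one of the two other nuisances is uniformly consistent
    (hor : (∀ k < K, BLearner.UnifConsistent P γ
        (fun n D x => (η.fit n k D).e x) (BLearner.propensity P)) ∨
      (∀ k < K, ∀ a : Bool, BLearner.UnifConsistent P γ
        (fun n D x => (η.fit n k D).ρ (s.arm a) x a)
        (fun x => BLearner.modifiedRegression Λ P (s.arm a) x a (qbar (s.arm a) x a)))) :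
    ∀ ε : ℝ, 0 < ε →
      Tendsto (fun n => BLearner.evalLaw γ P ν n
        {p | s.sgn * (BLearner.cateEstimator Λ η w s p.1 p.2 - BLearner.cateBound Λ P s p.2) < -ε})
        atTop (𝓝 0) := by
  obtain ⟨ε₀, hε₀, C, hprop, hY, hnuis⟩ := hbdd
  have hK0 : 0 < K := by omega
  have hC0 : 0 ≤ C := by
    obtain ⟨z, hz⟩ := hY.exists
    exact (abs_nonneg _).trans hz
  have hreg := BLearner.ae_regularAt hε₀ hprop hY
  have hbd := BLearner.ae_boundedAt hε₀ hnuis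
  -- The possibly wrong limits inherit a bound from the estimators of fold `0`; this makes `g`
  -- integrable, as Stone's theorem needs.
  have hqb : ∀ a : Bool, ∀ᵐ x ∂P.fst, |qbar (s.arm a) x a| ≤ C + 1 := fun a =>
    BLearner.ae_abs_le_of_unifConsistent (fun n => by
      filter_upwards [hbd n 0 hK0] with D hD
      filter_upwards [hD] with x hx using (hx a).2.2.1) (hq 0 hK0 a)
  set g : BLearner.Cov d → ℝ := fun x =>
    BLearner.putativeBound Λ (BLearner.condLaw P x) s (fun a => qbar (s.arm a) x a) with hg
  have hgm : Measurable g :=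
    (BLearner.measurable_armBound P Λ _ measurable_id true (hqbar true)).sub
      (BLearner.measurable_armBound P Λ _ measurable_id false (hqbar false))
  have hgint : Integrable g P.fst := by
    refine Integrable.of_bound hgm.aestronglyMeasurable
      (2 * ((C + 1) + (2 * Λ + 5) * (C + 1))) ?_
    filter_upwards [hreg, hqb true, hqb false] with x hx h1 h0
    have hx' : ∀ᵐ v ∂(BLearner.condLaw P x), |v.2| ≤ C + 1 := by
      filter_upwards [hx.2.2] with v hv using hv.trans (by linarith)
    rw [two_mul]
    exact (abs_sub _ _).trans (add_le_add
      (BLearner.abs_armBound_le hΛ hx' _ true (hx.armProb_pos true) h1)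
      (BLearner.abs_armBound_le hΛ hx' _ false (hx.armProb_pos false) h0))
  obtain ⟨M₀, hM₀⟩ := hStone.sum_abs_bounded
  obtain ⟨M, hM1, hM⟩ : ∃ M : ℝ, 0 < M ∧ ∀ n : ℕ, ∀ᵐ p ∂(BLearner.evalLaw γ P ν n),
      ∑ i : Fin n, |w.normalized i p.1 p.2| ≤ M :=
    ⟨max M₀ 1, lt_max_of_lt_right one_pos, fun n => by
      filter_upwards [hM₀ n] with p hp using hp.trans (le_max_left _ _)⟩
  have hνreg : ∀ᵐ x ∂ν, BLearner.RegularAt P C x :=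
    (BLearner.evalPoint_absolutelyContinuous hw hStone).ae_le hreg
  intro ε hε
  have hKr : (0 : ℝ) < K := by exact_mod_cast hK0
  -- The tolerance `ε` is split in three: smoothing; noise, shared equally by the `K` folds; and
  -- bias, where `ε / (3 * M)` per observation is enough because the absolute weights sum to at most
  -- `M`.
  have tS := BLearner.tendsto_weighted_average hw hStone hgm hgint (ε := ε / 3) (by positivity)
  have tN := fun k (hk : k < K) => BLearner.tendsto_centred_fold (ν := ν) hΛ hw hStone hη s hε₀ hY
    hreg (fun n => hbd n k hk) (ε := ε / (3 * K)) (by positivity)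
  have tB := fun k (hk : k < K) => BLearner.tendsto_bias_fold (ν := ν) hΛ hη s hε₀ hC0 hreg
    (fun n => hbd n k hk) (q := fun a x => qbar (s.arm a) x a) hqbar (hq k hk)
    (hor.imp (fun h => h k hk) fun h => h k hk) (κ := ε / (3 * M)) (by positivity)
  have hsum := tS.add ((tendsto_finsetSum (Finset.range K) fun k hk =>
    tN k (Finset.mem_range.1 hk)).add (tendsto_finsetSum (Finset.range K) fun k hk =>
    tB k (Finset.mem_range.1 hk)))
  simp only [Finset.sum_const_zero, add_zero] at hsum
  refine tendsto_of_tendsto_of_tendsto_of_le_of_le tendsto_const_nhds hsum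
    (fun _ => bot_le) fun n => ?_
  refine le_trans (measure_mono_ae ?_) ((measure_union_le _ _).trans (add_le_add le_rfl
    ((measure_union_le _ _).trans (add_le_add (measure_biUnion_finset_le _ _)
      (measure_biUnion_finset_le _ _)))))
  have hνreg' : ∀ᵐ p ∂(BLearner.evalLaw γ P ν n), BLearner.RegularAt P C p.2 :=
    Measure.quasiMeasurePreserving_snd.ae hνreg
  filter_upwards [hM n, hνreg'] with p hpM hpreg hbad
  by_contra hcon
  obtain ⟨n1, hcon'⟩ := not_or.1 hcon
  obtain ⟨n2, n3⟩ := not_or.1 hcon'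
  have m1 : |(∑ i : Fin n, w.normalized i p.1 p.2 * g (p.1.2 i).1) - g p.2| ≤ ε / 3 := not_lt.1 n1
  have m2 : ∀ k < K, |∑ i ∈ BLearner.foldIndices K k n, w.normalized i p.1 p.2 *
      (BLearner.pseudoCate Λ s (p.1.2 i) (η.fit n k p.1) -
        BLearner.pseudoMean Λ P s (η.fit n k p.1) (p.1.2 i).1)| ≤ ε / (3 * K) := by
    intro k hk
    by_contra hlt
    exact n2 (Set.mem_biUnion (Finset.mem_coe.2 (Finset.mem_range.2 hk)) (not_le.1 hlt))
  have m3 : ∀ k < K, ∀ i ∈ BLearner.foldIndices K k n,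
      |BLearner.pseudoMean Λ P s (η.fit n k p.1) (p.1.2 i).1 - g (p.1.2 i).1| ≤ ε / (3 * M) := by
    intro k hk
    by_contra hlt
    exact n3 (Set.mem_biUnion (Finset.mem_coe.2 (Finset.mem_range.2 hk)) hlt)
  have b2 : |∑ k ∈ Finset.range K, ∑ i ∈ BLearner.foldIndices K k n, w.normalized i p.1 p.2 *
      (BLearner.pseudoCate Λ s (p.1.2 i) (η.fit n k p.1) -
        BLearner.pseudoMean Λ P s (η.fit n k p.1) (p.1.2 i).1)| ≤ ε / 3 := by
    refine (Finset.abs_sum_le_sum_abs _ _).trans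
      ((Finset.sum_le_sum fun k hk => m2 k (Finset.mem_range.1 hk)).trans ?_)
    rw [Finset.sum_const, Finset.card_range, nsmul_eq_mul]
    apply le_of_eq
    field_simp
  have b3 : |∑ k ∈ Finset.range K, ∑ i ∈ BLearner.foldIndices K k n, w.normalized i p.1 p.2 *
      (BLearner.pseudoMean Λ P s (η.fit n k p.1) (p.1.2 i).1 - g (p.1.2 i).1)| ≤ ε / 3 := by
    have hfib : ∑ k ∈ Finset.range K, ∑ i ∈ BLearner.foldIndices K k n,
        |w.normalized i p.1 p.2| = ∑ i : Fin n, |w.normalized i p.1 p.2| :=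
      Finset.sum_fiberwise_of_maps_to (g := fun i : Fin n => (i : ℕ) % K)
        (fun i _ => Finset.mem_range.2 (Nat.mod_lt _ hK0)) _
    calc _ ≤ ∑ k ∈ Finset.range K, ∑ i ∈ BLearner.foldIndices K k n,
          |w.normalized i p.1 p.2| * (ε / (3 * M)) := by
          refine (Finset.abs_sum_le_sum_abs _ _).trans (Finset.sum_le_sum fun k hk =>
            (Finset.abs_sum_le_sum_abs _ _).trans (Finset.sum_le_sum fun i hi => ?_))
          rw [abs_mul]
          exact mul_le_mul_of_nonneg_left (m3 k (Finset.mem_range.1 hk) i hi) (abs_nonneg _)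
      _ = (∑ i : Fin n, |w.normalized i p.1 p.2|) * (ε / (3 * M)) := by
          rw [← hfib, Finset.sum_mul]
          simp only [Finset.sum_mul]
      _ ≤ M * (ε / (3 * M)) := by gcongr
      _ = ε / 3 := by field_simp
  have hdec := BLearner.cateEstimator_eq (P := P) (η := η) (w := w) Λ s hK0 p.1 p.2 g
  have htot : |BLearner.cateEstimator Λ η w s p.1 p.2 - g p.2| ≤ ε := by
    rw [hdec]
    rw [abs_le] at m1 b2 b3 ⊢
    constructor <;> linarith [m1.1, m1.2, b2.1, b2.2, b3.1, b3.2]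
  -- The only one-sided step: the error with respect to `g` is small in both directions, but `g` at
  -- wrong quantiles is merely conservative for the sharp bound.
  have hval : s.sgn * BLearner.cateBound Λ P s p.2 ≤ s.sgn * g p.2 :=
    BLearner.sgn_mul_cateBound_le hΛ P p.2 hpreg.1 hpreg.2.1 hpreg.2.2 s _
  have hbad' : s.sgn * (BLearner.cateEstimator Λ η w s p.1 p.2 -
    BLearner.cateBound Λ P s p.2) < -ε := hbad
  rw [abs_le] at htot
  cases s
  · simp only [BLearner.Side.sgn] at hbad' hval
    linarith [htot.1, htot.2]
  · simp only [BLearner.Side.sgn] at hbad' hval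
    linarith [htot.1, htot.2]
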